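/- Let $\Bbbk$ be a field of characteristic $2$, let $G=\langle\sigma,\tau\rangle$ be the Klein four-group, and let $\chi=\{\langle\sigma\rangle,\langle\tau\rangle,\langle\sigma\tau\rangle\}$ be the set of its proper nontrivial subgroups. Call a homomorphism of $\Bbbk G$-modules $\chi$-split if its corestriction to its image has a $\Bbbk H$-linear section for every $H\in\chi$, and call a $\Bbbk G$-module $Q$ projective relative to $\chi$ if every homomorphism $Q\to B$ lifts through every $\chi$-split surjection $A\to B$. Choose an exact sequence $\cdots\to Q_1\to Q_0\to\Bbbk\to 0$ of $\Bbbk G$-modules, where $\Bbbk$ carries the trivial action, in which every $Q_i$ is projective relative to $\chi$ and every map is $\chi$-split. Such a sequence exists, with all $Q_i$ finite-dimensional. For a $\Bbbk G$-module $N$ let $H^i_\chi(G,N)$ be the $i$-th cohomology of the complex $0\to\operatorname{Hom}_{\Bbbk G}(Q_0,N)\to\operatorname{Hom}_{\Bbbk G}(Q_1,N)\to\cdots$. For $n\ge 0$ let $V_{2n+1}$ be the $\Bbbk G$-module with basis $a_0,\dots,a_n,b_1,\dots,b_n$ on which $X=\sigma-1$ and $Y=\tau-1$ act by $Xa_0=0$,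 $Xa_i=b_i$ for $1\le i\le n$, $Ya_i=b_{i+1}$ for $0\le i<n$, $Ya_n=0$, and $Xb_i=Yb_i=0$ for all $i$. **Proposition.** Let $N\cong V_{2n+1}$ for some $n\ge 0$. Then, for every choice of the sequence above, 1. $\dim_\Bbbk H^0_\chi(G,N)=n$ if $n>0$, and $\dim_\Bbbk H^0_\chi(G,N)=1$ if $n=0$; 2. $\dim_\Bbbk H^i_\chi(G,N)=\max(0,\,n+2i-3)$ for every $i>0$. In particular $V_1\cong\Bbbk$ is the trivial module, so $\dim_\Bbbk H^0_\chi(G,\Bbbk)=1$ and $\dim_\Bbbk H^i_\chi(G,\Bbbk)=\max(0,\,2i-3)$ for $i>0$. -/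

import Mathlib

open CategoryTheory

universe u v w

namespace RelCohomology

section General

variable {k : Type u} [Field k] {G : Type v} [Group G]

/-- `f` splits on restriction to the subgroup `H`: the surjection of `f` onto its image has a
section which is a homomorphism of `kH`-modules. -/
def SplitsOver (H : Subgroup G) {A B : Rep.{w} k G} (f : A ⟶ B) : Prop :=
  ∃ s : Representation.IntertwiningMap
      (f.hom.range.toRepresentation.comp H.subtype) (A.ρ.comp H.subtype),
    ∀ y, f.hom (s y) = (y : B)

/-- `f` is `χ`-split: it splits on restriction to each `H ∈ χ`. -/
def IsRelSplit (χ : Set (Subgroup G)) {A B : Rep.{w} k G} (f : A ⟶ B) : Prop :=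
  ∀ H ∈ χ, SplitsOver H f

/-- `M` is projective relative to `χ`: every homomorphism `M ⟶ B` lifts through every
`χ`-split surjective homomorphism `A ⟶ B`. -/
def IsRelProjective (χ : Set (Subgroup G)) (M : Rep.{w} k G) : Prop :=
  ∀ ⦃A B : Rep.{w} k G⦄ (φ : M ⟶ B) (j : A ⟶ B),
    Function.Surjective j.hom → IsRelSplit χ j → ∃ ψ : M ⟶ A, ψ ≫ j = φ

/-- A resolution `⋯ ⟶ Q₁ ⟶ Q₀ ⟶ M ⟶ 0` of `M` that is projective relative to `χ`: an exact
sequence in which every `Qᵢ` is projective relative to `χ` and every map is `χ`-split. -/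
structure RelProjResolution (χ : Set (Subgroup G)) (M : Rep.{w} k G) where
  /-- the complex `⋯ ⟶ Q₁ ⟶ Q₀` -/
  complex : ChainComplex (Rep.{w} k G) ℕ
  /-- the augmentation `Q₀ ⟶ M` -/
  ε : complex.X 0 ⟶ M
  projective : ∀ i, IsRelProjective χ (complex.X i)
  exact_succ : ∀ i, Function.Exact (complex.d (i + 2) (i + 1)).hom (complex.d (i + 1) i).hom
  exact_zero : Function.Exact (complex.d 1 0).hom ε.hom
  surjective_ε : Function.Surjective ε.hom
  split_d : ∀ i, IsRelSplit χ (complex.d (i + 1) i)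
  split_ε : IsRelSplit χ ε

/-- The relative Ext group `Ext^i_{kG,χ}(M, N)` computed from the resolution `P` of `M`: the `i`-th
cohomology of `0 ⟶ Hom_{kG}(Q₀, N) ⟶ Hom_{kG}(Q₁, N) ⟶ ⋯`, as a `k`-vector space. -/
noncomputable def RelProjResolution.ext {χ : Set (Subgroup G)} {M : Rep.{w} k G}
    (P : RelProjResolution χ M) (N : Rep.{w} k G) (i : ℕ) : ModuleCat.{w} k :=
  (P.complex.linearYonedaObj k N).homology i

end General

section KleinFour

variable {k : Type u} [Field k] {G : Type v} [Group G]

/-- The set `χ = {⟨σ⟩, ⟨τ⟩, ⟨στ⟩}` of subgroups of the group generated by `σ` and `τ`. -/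
def properSubgroups (σ τ : G) : Set (Subgroup G) :=
  {Subgroup.zpowers σ, Subgroup.zpowers τ, Subgroup.zpowers (σ * τ)}

/-- For distinct non-identity elements `σ, τ` of a Klein four-group, the representation on which
`σ` and `τ` act by given commuting involutions `S` and `T`. -/
noncomputable def repOfInvolutions [IsKleinFour G] {σ τ : G} (hσ : σ ≠ 1) (hτ : τ ≠ 1)
    (hστ : σ ≠ τ) {V : Type w} [AddCommGroup V] [Module k V] (S T : Module.End k V)
    (hS : S * S = 1) (hT : T * T = 1) (hST : S * T = T * S) : Representation k G V := by
  classical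
  exact
  { toFun := fun g => if g = 1 then 1 else if g = σ then S else if g = τ then T else S * T
    map_one' := by simp
    map_mul' := by
      have hss := IsKleinFour.mul_self σ
      have htt := IsKleinFour.mul_self τ
      have hc : τ * σ = σ * τ := mul_comm_of_exponent_two IsKleinFour.exponent_two τ σ
      have h1 : σ * τ ≠ 1 := by
        intro h
        rw [mul_eq_one_iff_eq_inv, IsKleinFour.inv_eq_self] at h
        exact hστ h
      have h2 : ∀ x : G, σ * (σ * x) = x := fun x => by rw [← mul_assoc, hss, one_mul]
      have h4 : ∀ x : G, τ * (σ * x) = σ * (τ * x) := fun x => by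
        rw [← mul_assoc, hc, mul_assoc]
      have hS2 : ∀ x : Module.End k V, S * (S * x) = x := fun x => by
        rw [← mul_assoc, hS, one_mul]
      have hT2 : ∀ x : Module.End k V, T * (S * x) = S * (T * x) := fun x => by
        rw [← mul_assoc, ← hST, mul_assoc]
      have hall : ∀ x : G, x = 1 ∨ x = σ ∨ x = τ ∨ x = σ * τ := fun x => by
        by_contra h
        push Not at h
        exact h.2.2.2 (IsKleinFour.eq_mul_of_ne_all hσ hτ hστ h.1 h.2.1 h.2.2.1)
      intro x y
      rcases hall x with rfl | rfl | rfl | rfl <;> rcases hall y with rfl | rfl | rfl | rfl <;>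
        simp [hσ, hτ, hστ.symm, hss, htt, hc, h1, h2, h4, hS, hT, hST.symm, hS2, hT2,
          mul_assoc] }

/-- On the vector space with basis `a₀, …, aₙ, b₁, …, bₙ` (the `a`-coordinates, then the
`b`-coordinates), the operator `X` with `X a₀ = 0`, `X aᵢ = bᵢ` for `i ≥ 1` and `X bᵢ = 0`. -/
def opX (k : Type u) [Field k] (n : ℕ) : Module.End k ((Fin (n + 1) → k) × (Fin n → k)) where
  toFun v := (0, fun j => v.1 j.succ)
  map_add' _ _ := by ext <;> simp
  map_smul' _ _ := by ext <;> simp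

/-- The operator `Y` on the same space with `Y aₙ = 0`, `Y aᵢ = bᵢ₊₁` for `i < n` and
`Y bᵢ = 0`. -/
def opY (k : Type u) [Field k] (n : ℕ) : Module.End k ((Fin (n + 1) → k) × (Fin n → k)) where
  toFun v := (0, fun j => v.1 j.castSucc)
  map_add' _ _ := by ext <;> simp
  map_smul' _ _ := by ext <;> simp

lemma opX_mul_opX (n : ℕ) : opX k n * opX k n = 0 := by
  refine LinearMap.ext fun v => ?_
  simp [opX, Module.End.mul_apply]; rfl

lemma opY_mul_opY (n : ℕ) : opY k n * opY k n = 0 := by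
  refine LinearMap.ext fun v => ?_
  simp [opY, Module.End.mul_apply]; rfl

lemma opX_mul_opY (n : ℕ) : opX k n * opY k n = opY k n * opX k n := by
  refine LinearMap.ext fun v => ?_
  simp [opX, opY, Module.End.mul_apply]

lemma one_add_mul_self [CharP k 2] {V : Type w} [AddCommGroup V] [Module k V]
    {Z : Module.End k V} (hZ : Z * Z = 0) : (1 + Z) * (1 + Z) = 1 := by
  have h2 : Z + Z = 0 := by
    rw [← two_smul k Z, CharTwo.two_eq_zero, zero_smul]
  rw [add_mul, mul_add, mul_add, hZ, one_mul, one_mul, mul_one, add_zero, add_assoc, h2, add_zero]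

/-- The `kG`-module `V_{2n+1}` of dimension `2n+1`, with basis `a₀, …, aₙ, b₁, …, bₙ`, on which
`X = σ - 1` and `Y = τ - 1` act by `X aᵢ = bᵢ` (`1 ≤ i ≤ n`), `Y aᵢ = bᵢ₊₁` (`0 ≤ i < n`) and by
zero on all the other basis vectors. -/
noncomputable def oddModule (k : Type u) [Field k] [CharP k 2] [IsKleinFour G] {σ τ : G}
    (hσ : σ ≠ 1) (hτ : τ ≠ 1) (hστ : σ ≠ τ) (n : ℕ) : Rep.{u} k G :=
  Rep.of (repOfInvolutions hσ hτ hστ (1 + opX k n) (1 + opY k n)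
    (one_add_mul_self (opX_mul_opX n)) (one_add_mul_self (opY_mul_opY n))
    (by rw [add_mul, mul_add, mul_add, add_mul, mul_add, mul_add, opX_mul_opY]
        simp only [one_mul, mul_one]; abel))

end KleinFour

end RelCohomology

namespace RelCohomology

/-! ### Relatively split maps and lifting. -/

section General

variable {k : Type u} [Field k] {G : Type v} [Group G] {χ : Set (Subgroup G)}

/-! The usual comparison argument, with lifting through χ-split maps, shows that relatively
projective resolutions of the same module are homotopy equivalent
(`RelProjResolution.homotopyEquiv`). One explicit resolution of the trivial module therefore
suffices.

Let `V_{-(2m+1)}` have top `c₁, …, c_m` and socle `d₀, …, d_m`, with `X cⱼ = dⱼ` and `Y cⱼ = dⱼ₋₁`.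
Read `cⱼ` as `t^(j-1)` and `dⱼ` as `t^j`: from top to socle, `X` is multiplication by `t`, `Y` is
the inclusion of polynomials, and `στ - 1` is multiplication by `1 + t`. The image of each misses
one dimension of the socle. The free module of rank `m` maps onto the top, and the modules
`k[G/⟨σ⟩]`, `k[G/⟨τ⟩]`, `k[G/⟨στ⟩]` supply the three missing lines, so the sum of all four is a
cover that splits over each `H ∈ χ` (`exists_section_coverProjHom`). It is relatively projective
because χ-split surjections are onto on `H`-fixed vectors (`isRelProjective_cover`). Its kernel is
`V_{-(2(m+2)+1)}` (`exact_syzygyIncl_coverProj`). Starting from `V_{-1} ≅ k` and splicing gives a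
resolution with syzygies `Wᵢ = V_{-(4i+1)}`.

Left exactness of `Hom` and rank-nullity give `dim Ext^(i+1) = dim Hom(Wᵢ₊₁, N) + dim Hom(Wᵢ, N) -
dim Hom(Qᵢ, N)`. For `N = V_{2n+1}` and `m = 2i`, homomorphisms from `V_{-(2m+1)}` with `m > 0` are
Hankel matrices plus arbitrary maps from top to socle, of dimension `mn + m + n`
(`finrank_negOdd_hom`), and those from `Qᵢ` have dimension `m(2n+1) + 3(n+1)` (`finrank_cover_hom`).
For `i > 0` the result is `n + 2(i+1) - 3`. For `i = 0` the term `Hom(W₀, N)` is the space of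
invariants, of dimension `n`, or `1` if `n = 0`; this exception is the source of the maximum with
zero. -/

lemma SplitsOver.exists_section {H : Subgroup G} {A B : Rep.{w} k G} {f : A ⟶ B}
    (hf : SplitsOver H f) (hs : Function.Surjective f.hom) :
    ∃ s : B →ₗ[k] A, (∀ b, f.hom (s b) = b) ∧ ∀ h ∈ H, ∀ b, s (B.ρ h b) = A.ρ h (s b) := by
  obtain ⟨s, hs'⟩ := hf
  let c : B →ₗ[k] f.hom.range.toSubmodule := LinearMap.codRestrict _ LinearMap.id hs
  refine ⟨s.toLinearMap ∘ₗ c, fun b => hs' (c b), fun h hh b => ?_⟩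
  exact Representation.IntertwiningMap.isIntertwining _ _ s (⟨h, hh⟩ : H) (c b)

/-- A map with an `H`-linear section followed by an injective homomorphism splits over `H`. -/
lemma splitsOver_comp_of_section {H : Subgroup G} {A B C : Rep.{w} k G} (f : A ⟶ B) (i : B ⟶ C)
    (hi : Function.Injective i.hom) (s : B →ₗ[k] A) (hs : ∀ b, f.hom (s b) = b)
    (hH : ∀ h ∈ H, ∀ b, s (B.ρ h b) = A.ρ h (s b)) : SplitsOver H (f ≫ i) := by
  -- A `k`-linear left inverse is enough: it is only evaluated on the image of `i`, where it inverts
  -- an equivariant map.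
  obtain ⟨r, hr⟩ := LinearMap.exists_leftInverse_of_injective i.hom.toLinearMap
    (LinearMap.ker_eq_bot.2 hi)
  have hr' : ∀ b, r (i.hom b) = b := fun b => LinearMap.congr_fun hr b
  refine ⟨⟨s ∘ₗ r ∘ₗ Submodule.subtype _, fun h => ?_⟩, ?_⟩
  · ext ⟨_, a, rfl⟩
    change s (r (C.ρ h (i.hom (f.hom a)))) = A.ρ h (s (r (i.hom (f.hom a))))
    rw [← Rep.hom_comm_apply, hr', hr', hH _ h.2]
  · rintro ⟨_, a, rfl⟩
    change i.hom (f.hom (s (r (i.hom (f.hom a))))) = i.hom (f.hom a)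
    rw [hs, hr']

/-- The injection `i` identifies the image of `g` with that of `f`, so the section transports. This
turns a χ-split map into a χ-split surjection onto its image, which is what relative projectivity
can be applied to. -/
lemma SplitsOver.corestrict {H : Subgroup G} {A B : Rep.{w} k G} {f : A ⟶ B}
    (hf : SplitsOver H f) {C : Rep.{w} k G} (g : A ⟶ C) (i : C ⟶ B)
    (hi : Function.Injective i.hom) (hgi : g ≫ i = f) : SplitsOver H g := by
  obtain ⟨s, hs⟩ := hf
  have hif : ∀ a, i.hom (g.hom a) = f.hom a := fun a => by rw [← hgi]; rfl
  let c : g.hom.range.toSubmodule →ₗ[k] f.hom.range.toSubmodule :=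
    LinearMap.codRestrict _ (i.hom.toLinearMap ∘ₗ Submodule.subtype _) (by
      rintro ⟨_, a, rfl⟩
      exact ⟨a, (hif a).symm⟩)
  refine ⟨⟨s.toLinearMap ∘ₗ c, fun h => ?_⟩, fun y => hi ?_⟩
  · ext y
    have : c ((g.hom.range.toRepresentation.comp H.subtype) h y) =
        (f.hom.range.toRepresentation.comp H.subtype) h (c y) :=
      Subtype.ext (Rep.hom_comm_apply i h y.1)
    change s (c _) = _
    rw [this]
    exact Representation.IntertwiningMap.isIntertwining _ _ s h (c y)
  · rw [hif]
    exact hs (c y)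

/-- A homomorphism from a relatively projective module lifts through a `χ`-split map `g` when it is
killed by the next map of a sequence exact at the target of `g`. -/
lemma IsRelProjective.exists_lift {M A B C : Rep.{w} k G} (hM : IsRelProjective χ M)
    (φ : M ⟶ B) (g : A ⟶ B) (h : B ⟶ C) (hg : IsRelSplit χ g)
    (hgh : Function.Exact g.hom h.hom) (hφ : φ ≫ h = 0) : ∃ ψ : M ⟶ A, ψ ≫ g = φ := by
  let R : Rep.{w} k G := Rep.of g.hom.range.toRepresentation
  let i : R ⟶ B := Rep.ofHom ⟨Submodule.subtype _, fun _ => rfl⟩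
  let g' : A ⟶ R := Rep.ofHom ⟨g.hom.toLinearMap.rangeRestrict, fun x => by
    ext a; exact Rep.hom_comm_apply g x a⟩
  let φ' : M ⟶ R := Rep.ofHom ⟨LinearMap.codRestrict _ φ.hom.toLinearMap fun m => by
    refine (hgh (φ.hom m)).1 ?_
    exact congr(($hφ).hom m), fun x => by
    ext a; exact Rep.hom_comm_apply φ x a⟩
  have hi : Function.Injective i.hom := Subtype.val_injective
  obtain ⟨ψ, hψ⟩ := hM φ' g' g.hom.toLinearMap.surjective_rangeRestrict
    fun H hH => (hg H hH).corestrict g' i hi rfl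
  exact ⟨ψ, congr($hψ ≫ i)⟩

end General

/-! ### Comparison of relatively projective resolutions. -/

section General

variable {k : Type u} [Field k] {G : Type v} [Group G] {χ : Set (Subgroup G)}

lemma comp_eq_zero_of_exact {A B C : Rep.{w} k G} {f : A ⟶ B} {g : B ⟶ C}
    (h : Function.Exact f.hom g.hom) : f ≫ g = 0 := by
  ext a
  exact h.apply_apply_eq_zero a

namespace RelProjResolution

variable {M : Rep.{w} k G}

lemma exists_lift_ε (P P' : RelProjResolution χ M) :
    ∃ ψ : P.complex.X 0 ⟶ P'.complex.X 0, ψ ≫ P'.ε = P.ε :=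
  P.projective 0 P.ε P'.ε P'.surjective_ε P'.split_ε

lemma exists_lift_zero (P P' : RelProjResolution χ M) (i : ℕ)
    (φ : P.complex.X i ⟶ P'.complex.X 0) (hφ : φ ≫ P'.ε = 0) :
    ∃ ψ : P.complex.X i ⟶ P'.complex.X 1, ψ ≫ P'.complex.d 1 0 = φ :=
  (P.projective i).exists_lift φ _ _ (P'.split_d 0) P'.exact_zero hφ

lemma exists_lift_succ (P P' : RelProjResolution χ M) (i n : ℕ)
    (φ : P.complex.X i ⟶ P'.complex.X (n + 1)) (hφ : φ ≫ P'.complex.d (n + 1) n = 0) :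
    ∃ ψ : P.complex.X i ⟶ P'.complex.X (n + 2), ψ ≫ P'.complex.d (n + 2) (n + 1) = φ :=
  (P.projective i).exists_lift φ _ _ (P'.split_d (n + 1)) (P'.exact_succ n) hφ

lemma d_comp_ε (P : RelProjResolution χ M) : P.complex.d 1 0 ≫ P.ε = 0 :=
  comp_eq_zero_of_exact P.exact_zero

lemma exists_lift_one (P P' : RelProjResolution χ M) :
    ∃ ψ : P.complex.X 1 ⟶ P'.complex.X 1,
      ψ ≫ P'.complex.d 1 0 = P.complex.d 1 0 ≫ (exists_lift_ε P P').choose :=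
  exists_lift_zero P P' 1 _ (by
    rw [Category.assoc, (exists_lift_ε P P').choose_spec, d_comp_ε])

/-- The comparison map between two relatively projective resolutions of the same module. -/
noncomputable def lift (P P' : RelProjResolution χ M) : P.complex ⟶ P'.complex :=
  ChainComplex.mkHom _ _ (exists_lift_ε P P').choose (exists_lift_one P P').choose
    (exists_lift_one P P').choose_spec fun n ⟨g, g', w⟩ =>
      have h := exists_lift_succ P P' (n + 2) n (P.complex.d (n + 2) (n + 1) ≫ g') (by
        rw [Category.assoc, w, HomologicalComplex.d_comp_d_assoc, Limits.zero_comp])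
      ⟨h.choose, h.choose_spec⟩

lemma lift_ε (P P' : RelProjResolution χ M) : (lift P P').f 0 ≫ P'.ε = P.ε := by
  rw [lift, ChainComplex.mkHom_f_0]
  exact (exists_lift_ε P P').choose_spec

lemma nonempty_homotopy_zero {P P' : RelProjResolution χ M} (f : P.complex ⟶ P'.complex)
    (hf : f.f 0 ≫ P'.ε = 0) : Nonempty (Homotopy f 0) := by
  obtain ⟨h₀, e₀⟩ := exists_lift_zero P P' 0 (f.f 0) hf
  obtain ⟨h₁, e₁⟩ := exists_lift_succ P P' 1 0 (f.f 1 - P.complex.d 1 0 ≫ h₀) (by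
    rw [Preadditive.sub_comp, Category.assoc, e₀, HomologicalComplex.Hom.comm, sub_self])
  refine ⟨Homotopy.mkInductive _ h₀ e₀.symm h₁ (sub_eq_iff_eq_add'.1 e₁.symm)
    fun n ⟨g, g', w⟩ => ?_⟩
  have h := exists_lift_succ P P' (n + 2) (n + 1) (f.f (n + 2) - P.complex.d _ _ ≫ g') (by
    rw [Preadditive.sub_comp, HomologicalComplex.Hom.comm, w]
    simp)
  exact ⟨h.choose, by rw [h.choose_spec]; abel⟩

lemma nonempty_homotopy {P P' : RelProjResolution χ M} (f g : P.complex ⟶ P'.complex)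
    (hfg : f.f 0 ≫ P'.ε = g.f 0 ≫ P'.ε) : Nonempty (Homotopy f g) := by
  obtain ⟨h⟩ := nonempty_homotopy_zero (f - g) (by
    rw [HomologicalComplex.sub_f_apply, Preadditive.sub_comp, hfg, sub_self])
  exact ⟨Homotopy.equivSubZero.symm h⟩

/-- Any two relatively projective resolutions of a module are homotopy equivalent. -/
noncomputable def homotopyEquiv (P P' : RelProjResolution χ M) :
    HomotopyEquiv P.complex P'.complex where
  hom := lift P P'
  inv := lift P' P
  homotopyHomInvId := (nonempty_homotopy _ _ (by simp [lift_ε])).some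
  homotopyInvHomId := (nonempty_homotopy _ _ (by simp [lift_ε])).some

/-- The relative Ext groups do not depend on the choice of the resolution. -/
noncomputable def extIso (P P' : RelProjResolution χ M) (N : Rep.{w} k G) (i : ℕ) :
    P.ext N i ≅ P'.ext N i :=
  -- The Hom complex is the `unop` of the image of the resolution under an additive functor to the
  -- opposite category; that functor preserves homotopy equivalences, and homology commutes with
  -- `unop`.
  HomologicalComplex.homologyUnop _ _ ≪≫
    ((((linearYoneda k (Rep.{w} k G)).obj N).rightOp.mapHomotopyEquiv
      (homotopyEquiv P P')).toHomologyIso i).unop.symm ≪≫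
    (HomologicalComplex.homologyUnop _ _).symm

end RelProjResolution

end General

/-! ### Dimensions of relative Ext from syzygies, and splicing of short exact sequences. -/

section General

variable {k : Type u} [Field k]

/-- Homology is kernel modulo image; the dimension formula is kept additive to avoid truncated
subtraction. -/
lemma finite_and_finrank_homology (S : ShortComplex (ModuleCat.{w} k)) [Module.Finite k S.X₂] :
    Module.Finite k S.homology ∧
      Module.finrank k S.homology + Module.finrank k (LinearMap.range S.f.hom) =
        Module.finrank k (LinearMap.ker S.g.hom) := by
  let e := S.moduleCatHomologyIso.toLinearEquiv
  have hr : Module.finrank k (LinearMap.range S.moduleCatToCycles) =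
      Module.finrank k (LinearMap.range S.f.hom) := by
    have h := LinearMap.range_comp S.moduleCatToCycles (Submodule.subtype (LinearMap.ker S.g.hom))
    have h2 : Submodule.subtype (LinearMap.ker S.g.hom) ∘ₗ S.moduleCatToCycles = S.f.hom := rfl
    rw [← h2, h]
    exact (LinearEquiv.finrank_eq (Submodule.equivMapOfInjective _
      (Submodule.injective_subtype _) _))
  have : Module.Finite k S.moduleCatLeftHomologyData.H :=
    inferInstanceAs (Module.Finite k (LinearMap.ker S.g.hom ⧸ LinearMap.range S.moduleCatToCycles))
  refine ⟨Module.Finite.equiv e.symm, ?_⟩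
  rw [e.finrank_eq, ← hr]
  exact Submodule.finrank_quotient_add_finrank (LinearMap.range S.moduleCatToCycles)

lemma finite_and_finrank_homology_succ (K : CochainComplex (ModuleCat.{w} k) ℕ) (i : ℕ)
    [Module.Finite k (K.X (i + 1))] :
    Module.Finite k (K.homology (i + 1)) ∧
      Module.finrank k (K.homology (i + 1)) +
        Module.finrank k (LinearMap.range (K.d i (i + 1)).hom) =
        Module.finrank k (LinearMap.ker (K.d (i + 1) (i + 2)).hom) := by
  have : Module.Finite k (K.sc' i (i + 1) (i + 2)).X₂ := ‹_›
  obtain ⟨h1, h2⟩ := finite_and_finrank_homology (K.sc' i (i + 1) (i + 2))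
  let e := (ShortComplex.homologyMapIso
    (K.isoSc' i (i + 1) (i + 2) (by simp) (by simp))).toLinearEquiv
  exact ⟨Module.Finite.equiv e.symm, (congrArg (· + _) e.finrank_eq).trans h2⟩

lemma finite_and_finrank_homology_zero (K : CochainComplex (ModuleCat.{w} k) ℕ)
    [Module.Finite k (K.X 0)] :
    Module.Finite k (K.homology 0) ∧
      Module.finrank k (K.homology 0) = Module.finrank k (LinearMap.ker (K.d 0 1).hom) := by
  have : Module.Finite k (K.sc' 0 0 1).X₂ := ‹_›
  obtain ⟨h1, h2⟩ := finite_and_finrank_homology (K.sc' 0 0 1)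
  have h0 : (K.sc' 0 0 1).f.hom = 0 := by
    change (K.d 0 0).hom = 0
    rw [K.shape 0 0 (by simp)]
    rfl
  rw [h0, LinearMap.range_zero, finrank_bot, add_zero] at h2
  let e := (ShortComplex.homologyMapIso (K.isoSc' 0 0 1 (by simp) (by simp))).toLinearEquiv
  exact ⟨Module.Finite.equiv e.symm, e.finrank_eq.trans h2⟩

variable {G : Type v} [Group G] {χ : Set (Subgroup G)}

instance finite_hom (A B : Rep.{w} k G) [Module.Finite k A] [Module.Finite k B] :
    Module.Finite k (A ⟶ B) :=
  Module.Finite.equiv (Rep.homLinearEquiv A B).symm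

/-- This is left exactness of `Hom(-, N)`: `p` is a cokernel of `f`, so the maps killed by `f` are
exactly those factoring through `p`. -/
lemma finrank_ker_leftComp {A B C : Rep.{w} k G} (f : A ⟶ B) (p : B ⟶ C)
    (hfp : Function.Exact f.hom p.hom) (hp : Function.Surjective p.hom) (N : Rep.{w} k G) :
    Module.finrank k (LinearMap.ker (Linear.leftComp k N f)) = Module.finrank k (C ⟶ N) := by
  have hinj : Function.Injective (Linear.leftComp k N p) := by
    intro φ ψ h
    ext c
    obtain ⟨b, rfl⟩ := hp c
    exact congr(($h).hom b)
  rw [← LinearMap.finrank_range_of_inj hinj]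
  suffices LinearMap.ker (Linear.leftComp k N f) = LinearMap.range (Linear.leftComp k N p) by
    rw [this]
  ext φ
  simp only [LinearMap.mem_ker, LinearMap.mem_range, Linear.leftComp_apply]
  constructor
  · intro h
    -- The section is only `k`-linear, but `φ` kills the kernel of `p`, so `φ ∘ s` does not depend
    -- on it and is equivariant.
    obtain ⟨s, hs⟩ := LinearMap.exists_rightInverse_of_surjective p.hom.toLinearMap
      (LinearMap.range_eq_top.2 hp)
    have hs' : ∀ c, p.hom (s c) = c := fun c => LinearMap.congr_fun hs c
    have key : ∀ b, φ.hom (s (p.hom b)) = φ.hom b := by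
      intro b
      rw [← sub_eq_zero, ← map_sub]
      obtain ⟨a, ha⟩ := (hfp (s (p.hom b) - b)).1 (by rw [map_sub, hs', sub_self])
      rw [← ha]
      exact congr(($h).hom a)
    refine ⟨Rep.ofHom ⟨φ.hom.toLinearMap ∘ₗ s, fun g => ?_⟩, ?_⟩
    · ext c
      obtain ⟨b, rfl⟩ := hp c
      change φ.hom (s (C.ρ g (p.hom b))) = N.ρ g (φ.hom (s (p.hom b)))
      rw [← Rep.hom_comm_apply, key, key, Rep.hom_comm_apply]
    · ext b
      exact key b
  · rintro ⟨ψ, rfl⟩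
    rw [← Category.assoc, comp_eq_zero_of_exact hfp, Limits.zero_comp]

/-- The dimension of relative Ext in terms of dimensions of spaces of homomorphisms, for a
resolution by finite-dimensional modules with given syzygies `W i`. -/
lemma RelProjResolution.finite_and_finrank_ext {M : Rep.{w} k G} (P : RelProjResolution χ M)
    (W : ℕ → Rep.{w} k G) (π : ∀ i, P.complex.X i ⟶ W i)
    (hπ : ∀ i, Function.Surjective (π i).hom)
    (hex : ∀ i, Function.Exact (P.complex.d (i + 1) i).hom (π i).hom)
    (N : Rep.{w} k G) [∀ i, Module.Finite k (P.complex.X i)] [Module.Finite k N] :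
    (Module.Finite k (P.ext N 0) ∧ Module.finrank k (P.ext N 0) = Module.finrank k (W 0 ⟶ N)) ∧
    ∀ i, Module.Finite k (P.ext N (i + 1)) ∧
      Module.finrank k (P.ext N (i + 1)) + Module.finrank k (P.complex.X i ⟶ N) =
        Module.finrank k (W (i + 1) ⟶ N) + Module.finrank k (W i ⟶ N) := by
  have hX : ∀ i, Module.Finite k ((P.complex.linearYonedaObj k N).X i) := fun i =>
    finite_hom (P.complex.X i) N
  have hk : ∀ i, Module.finrank k
      (LinearMap.ker ((P.complex.linearYonedaObj k N).d i (i + 1)).hom) =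
        Module.finrank k (W i ⟶ N) := fun i =>
    finrank_ker_leftComp _ (π i) (hex i) (hπ i) N
  refine ⟨?_, fun i => ?_⟩
  · have h := finite_and_finrank_homology_zero (P.complex.linearYonedaObj k N)
    rw [hk] at h
    exact h
  · obtain ⟨h1, h2⟩ := finite_and_finrank_homology_succ (P.complex.linearYonedaObj k N) i
    refine ⟨h1, ?_⟩
    -- The coboundaries in degree `i + 1` have dimension `dim Hom(Qᵢ, N) - dim Hom(Wᵢ, N)`.
    have h3 := LinearMap.finrank_range_add_finrank_ker
      ((P.complex.linearYonedaObj k N).d i (i + 1)).hom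
    rw [hk] at h2 h3
    change _ = Module.finrank k (P.complex.X i ⟶ N) at h3
    change Module.finrank k (P.ext N (i + 1)) + _ = _ at h2
    omega

lemma of_d_succ (Q : ℕ → Rep.{w} k G) (d : ∀ i, Q (i + 1) ⟶ Q i)
    (sq : ∀ i, d (i + 1) ≫ d i = 0) (i : ℕ) : (ChainComplex.of Q d sq).d (i + 1) i = d i :=
  ChainComplex.of_d Q d i

/-- The resolution obtained by splicing short exact sequences
`0 ⟶ W (i + 1) ⟶ Q i ⟶ W i ⟶ 0` which split over every `H ∈ χ`. -/
noncomputable def spliceResolution {M : Rep.{w} k G} (W Q : ℕ → Rep.{w} k G)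
    (π : ∀ i, Q i ⟶ W i) (ι : ∀ i, W (i + 1) ⟶ Q i) (e : W 0 ⟶ M)
    (he : Function.Bijective e.hom)
    (hι : ∀ i, Function.Injective (ι i).hom) (hex : ∀ i, Function.Exact (ι i).hom (π i).hom)
    (hQ : ∀ i, IsRelProjective χ (Q i))
    (hs : ∀ i, ∀ H ∈ χ, ∃ s : W i →ₗ[k] Q i, (∀ b, (π i).hom (s b) = b) ∧
      ∀ h ∈ H, ∀ b, s ((W i).ρ h b) = (Q i).ρ h (s b))
    (hπ : ∀ i, Function.Surjective (π i).hom) : RelProjResolution χ M where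
  complex := ChainComplex.of Q (fun i => π (i + 1) ≫ ι i) (fun i => by
    have := comp_eq_zero_of_exact (hex (i + 1))
    rw [Category.assoc, reassoc_of% this, Limits.zero_comp, Limits.comp_zero])
  ε := π 0 ≫ e
  projective := hQ
  exact_succ i := by
    rw [of_d_succ, of_d_succ]
    intro y
    change (ι i).hom ((π (i + 1)).hom y) = 0 ↔ ∃ z, (ι (i + 1)).hom ((π (i + 2)).hom z) = y
    -- Injectivity of `ι i` reduces the kernel to that of `π (i + 1)`, and surjectivity of `π (i +
    -- 2)` lets the image of `ι (i + 1)` be reached from `Q (i + 2)`.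
    rw [map_eq_zero_iff _ (hι i), hex (i + 1)]
    exact ((hπ (i + 2)).exists (p := fun w => (ι (i + 1)).hom w = y))
  exact_zero := by
    rw [of_d_succ]
    intro y
    change e.hom ((π 0).hom y) = 0 ↔ ∃ z, (ι 0).hom ((π 1).hom z) = y
    rw [map_eq_zero_iff _ he.1, hex 0]
    exact ((hπ 1).exists (p := fun w => (ι 0).hom w = y))
  surjective_ε := he.2.comp (hπ 0)
  split_d i H hH := by
    rw [of_d_succ]
    obtain ⟨s, h1, h2⟩ := hs (i + 1) H hH
    exact splitsOver_comp_of_section _ _ (hι i) s h1 h2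
  split_ε H hH := by
    obtain ⟨s, h1, h2⟩ := hs 0 H hH
    exact splitsOver_comp_of_section _ _ he.1 s h1 h2

lemma exact_spliceResolution {M : Rep.{w} k G} (W Q : ℕ → Rep.{w} k G)
    (π : ∀ i, Q i ⟶ W i) (ι : ∀ i, W (i + 1) ⟶ Q i) (e : W 0 ⟶ M)
    (he : Function.Bijective e.hom)
    (hι : ∀ i, Function.Injective (ι i).hom) (hex : ∀ i, Function.Exact (ι i).hom (π i).hom)
    (hQ : ∀ i, IsRelProjective χ (Q i))
    (hs : ∀ i, ∀ H ∈ χ, ∃ s : W i →ₗ[k] Q i, (∀ b, (π i).hom (s b) = b) ∧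
      ∀ h ∈ H, ∀ b, s ((W i).ρ h b) = (Q i).ρ h (s b))
    (hπ : ∀ i, Function.Surjective (π i).hom) (i : ℕ) :
    Function.Exact
      ((spliceResolution W Q π ι e he hι hex hQ hs hπ).complex.d (i + 1) i).hom (π i).hom := by
  have hd : (spliceResolution W Q π ι e he hι hex hQ hs hπ).complex.d (i + 1) i =
      π (i + 1) ≫ ι i := ChainComplex.of_d Q (fun i => π (i + 1) ≫ ι i) i
  rw [hd]
  intro y
  refine (hex i y).trans ?_
  exact (hπ (i + 1)).exists (p := fun w => (ι i).hom w = y)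

end General

/-! ### Representations of the Klein four-group as pairs of commuting square-zero operators. -/

section KleinFour

variable {k : Type u} [Field k] {G : Type v} [Group G]

lemma comm_of_mem_zpowers {A B : Rep.{w} k G} {g : G} (s : B →ₗ[k] A)
    (hg : ∀ b, s (B.ρ g b) = A.ρ g (s b)) {h : G} (hh : h ∈ Subgroup.zpowers g) (b : B) :
    s (B.ρ h b) = A.ρ h (s b) := by
  rw [Subgroup.zpowers_eq_closure] at hh
  induction hh using Subgroup.closure_induction generalizing b with
  | mem x hx => obtain rfl := hx; exact hg b
  | one => simp
  | mul x y _ _ hx hy => simp [hx, hy]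
  | inv x _ hx =>
    have := hx (B.ρ x⁻¹ b)
    rw [← Module.End.mul_apply, ← map_mul, mul_inv_cancel, map_one, Module.End.one_apply] at this
    rw [this, ← Module.End.mul_apply, ← map_mul, inv_mul_cancel, map_one, Module.End.one_apply]

variable [IsKleinFour G] {σ τ : G}

lemma eq_one_or_eq (hσ : σ ≠ 1) (hτ : τ ≠ 1) (hστ : σ ≠ τ) (x : G) :
    x = 1 ∨ x = σ ∨ x = τ ∨ x = σ * τ := by
  by_contra h
  push Not at h
  exact h.2.2.2 (IsKleinFour.eq_mul_of_ne_all hσ hτ hστ h.1 h.2.1 h.2.2.1)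

/-- A linear map commuting with the two generators is a homomorphism of representations. -/
def homOfComm (hσ : σ ≠ 1) (hτ : τ ≠ 1) (hστ : σ ≠ τ) {A B : Rep.{w} k G} (f : A →ₗ[k] B)
    (h₁ : ∀ a, f (A.ρ σ a) = B.ρ σ (f a)) (h₂ : ∀ a, f (A.ρ τ a) = B.ρ τ (f a)) : A ⟶ B :=
  Rep.ofHom ⟨f, fun g => by
    ext a
    rcases eq_one_or_eq hσ hτ hστ g with rfl | rfl | rfl | rfl <;> simp [h₁, h₂]⟩

/-- Two commuting operators of square zero on a vector space. -/
structure SqZeroPair (k : Type u) [Field k] (V : Type w) [AddCommGroup V] [Module k V] where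
  /-- the first operator -/
  X : Module.End k V
  /-- the second operator -/
  Y : Module.End k V
  X_mul_X : X * X = 0
  Y_mul_Y : Y * Y = 0
  X_mul_Y : X * Y = Y * X

variable [CharP k 2]

/-- The representation on which `σ - 1` and `τ - 1` act by the given commuting operators of square
zero. -/
noncomputable def kleinRepresentation (hσ : σ ≠ 1) (hτ : τ ≠ 1) (hστ : σ ≠ τ) {V : Type w}
    [AddCommGroup V] [Module k V] (D : SqZeroPair k V) : Representation k G V :=
  repOfInvolutions hσ hτ hστ (1 + D.X) (1 + D.Y) (one_add_mul_self D.X_mul_X)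
    (one_add_mul_self D.Y_mul_Y)
    (by rw [add_mul, mul_add, mul_add, add_mul, mul_add, mul_add, D.X_mul_Y]
        simp only [one_mul, mul_one]; abel)

/-- The bundled form of `kleinRepresentation`. -/
noncomputable abbrev kleinRep (hσ : σ ≠ 1) (hτ : τ ≠ 1) (hστ : σ ≠ τ) {V : Type w}
    [AddCommGroup V] [Module k V] (D : SqZeroPair k V) : Rep.{w} k G :=
  Rep.of (kleinRepresentation hσ hτ hστ D)

section

variable (hσ : σ ≠ 1) (hτ : τ ≠ 1) (hστ : σ ≠ τ) {V V' : Type w} [AddCommGroup V] [Module k V]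
  [AddCommGroup V'] [Module k V'] (D : SqZeroPair k V) (D' : SqZeroPair k V')

@[simp]
lemma kleinRepresentation_left (v : V) : kleinRepresentation hσ hτ hστ D σ v = v + D.X v := by
  simp [kleinRepresentation, repOfInvolutions, hσ]

@[simp]
lemma kleinRepresentation_right (v : V) : kleinRepresentation hσ hτ hστ D τ v = v + D.Y v := by
  simp [kleinRepresentation, repOfInvolutions, hτ, hστ.symm]

variable {D D'}

/-- A linear map commuting with the operators `σ - 1` and `τ - 1`, as a homomorphism. -/
noncomputable def kleinHom (f : V →ₗ[k] V') (h₁ : ∀ v, f (D.X v) = D'.X (f v))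
    (h₂ : ∀ v, f (D.Y v) = D'.Y (f v)) : kleinRep hσ hτ hστ D ⟶ kleinRep hσ hτ hστ D' :=
  homOfComm hσ hτ hστ f (fun v => by simp [h₁]) (fun v => by simp [h₂])

@[simp]
lemma kleinHom_apply (f : V →ₗ[k] V') (h₁ : ∀ v, f (D.X v) = D'.X (f v))
    (h₂ : ∀ v, f (D.Y v) = D'.Y (f v)) (v : V) :
    (kleinHom hσ hτ hστ f h₁ h₂).hom v = f v := rfl

variable {hσ hτ hστ}

lemma hom_kleinRep_left {A : Rep.{w} k G} (f : kleinRep hσ hτ hστ D ⟶ A) (v : V) :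
    f.hom (D.X v) = A.ρ σ (f.hom v) - f.hom v := by
  rw [← Rep.hom_comm_apply, kleinRepresentation_left, map_add, add_sub_cancel_left]

lemma hom_kleinRep_right {A : Rep.{w} k G} (f : kleinRep hσ hτ hστ D ⟶ A) (v : V) :
    f.hom (D.Y v) = A.ρ τ (f.hom v) - f.hom v := by
  rw [← Rep.hom_comm_apply, kleinRepresentation_right, map_add, add_sub_cancel_left]

lemma hom_X (f : kleinRep hσ hτ hστ D ⟶ kleinRep hσ hτ hστ D') (v : V) :
    f.hom (D.X v) = D'.X (f.hom v) := by
  rw [hom_kleinRep_left, kleinRepresentation_left, add_sub_cancel_left]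

lemma hom_Y (f : kleinRep hσ hτ hστ D ⟶ kleinRep hσ hτ hστ D') (v : V) :
    f.hom (D.Y v) = D'.Y (f.hom v) := by
  rw [hom_kleinRep_right, kleinRepresentation_right, add_sub_cancel_left]

end

end KleinFour

/-! ### The covering modules and their relative projectivity. -/

section KleinFour

variable {k : Type u} [Field k] {G : Type v} [Group G]

/-- The action of `g - 1`. -/
def aug (A : Rep.{w} k G) (g : G) : A →ₗ[k] A := A.ρ g - LinearMap.id

lemma ρ_eq_add_aug (A : Rep.{w} k G) (g : G) (a : A) : A.ρ g a = a + aug A g a := by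
  simp [aug]

lemma hom_aug {A B : Rep.{w} k G} (f : A ⟶ B) (g : G) (a : A) :
    f.hom (aug A g a) = aug B g (f.hom a) := by
  simp [aug, Rep.hom_comm_apply]

lemma ρ_eq_self_iff (A : Rep.{w} k G) (g : G) (a : A) : A.ρ g a = a ↔ aug A g a = 0 := by
  simp [aug, sub_eq_zero]

/-- The space underlying the module `kG ⊗ T ⊕ k[G/⟨σ⟩] ⊕ k[G/⟨τ⟩] ⊕ k[G/⟨στ⟩]`: the first four
coordinates are those at `1, X, Y, XY`. -/
abbrev Cover (k : Type u) (T : Type w) : Type (max u w) :=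
  (T × T) × (T × T) × (k × k) × (k × k) × (k × k)

/-- The operators `σ - 1` and `τ - 1` on `Cover k T`. -/
def coverPair (k : Type u) [Field k] (T : Type w) [AddCommGroup T] [Module k T] :
    SqZeroPair k (Cover k T) where
  X :=
    { toFun v := ((0, v.1.1), (0, v.2.1.1), (0, 0), (0, v.2.2.2.1.1), (0, v.2.2.2.2.1))
      map_add' _ _ := by simp
      map_smul' _ _ := by simp }
  Y :=
    { toFun v := ((0, 0), v.1, (0, v.2.2.1.1), (0, 0), (0, v.2.2.2.2.1))
      map_add' _ _ := by simp
      map_smul' _ _ := by simp }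
  X_mul_X := rfl
  Y_mul_Y := rfl
  X_mul_Y := rfl

variable {σ τ : G} {T : Type u} [AddCommGroup T] [Module k T] {A : Rep.{u} k G}

/-- The linear map out of `Cover k T` which extends given values on the generators. -/
def coverLinear (σ τ : G) (A : Rep.{u} k G) (L : T →ₗ[k] A) (y₁ y₂ y₃ : A) :
    Cover k T →ₗ[k] A where
  toFun v := L v.1.1 + aug A σ (L v.1.2) + aug A τ (L v.2.1.1) + aug A σ (aug A τ (L v.2.1.2)) +
    (v.2.2.1.1 • y₁ + v.2.2.1.2 • aug A τ y₁) +
    (v.2.2.2.1.1 • y₂ + v.2.2.2.1.2 • aug A σ y₂) +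
    (v.2.2.2.2.1 • y₃ + v.2.2.2.2.2 • aug A σ y₃)
  map_add' v w := by simp only [Prod.fst_add, Prod.snd_add, map_add, add_smul]; abel
  map_smul' c v := by
    simp only [Prod.smul_fst, Prod.smul_snd, map_smul, smul_add, smul_assoc, RingHom.id_apply]

section

variable (L : T →ₗ[k] A) (y₁ y₂ y₃ : A)

lemma coverLinear_one (t : T) :
    coverLinear σ τ A L y₁ y₂ y₃ ((t, 0), (0, 0), (0, 0), (0, 0), (0, 0)) = L t := by
  simp [coverLinear]

lemma coverLinear_left :
    coverLinear σ τ A L y₁ y₂ y₃ ((0, 0), (0, 0), (1, 0), (0, 0), (0, 0)) = y₁ := by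
  simp [coverLinear]

lemma coverLinear_right :
    coverLinear σ τ A L y₁ y₂ y₃ ((0, 0), (0, 0), (0, 0), (1, 0), (0, 0)) = y₂ := by
  simp [coverLinear]

lemma coverLinear_mul :
    coverLinear σ τ A L y₁ y₂ y₃ ((0, 0), (0, 0), (0, 0), (0, 0), (1, 0)) = y₃ := by
  simp [coverLinear]

end

variable [IsKleinFour G]

lemma aug_comm (A : Rep.{w} k G) (σ τ : G) (a : A) :
    aug A τ (aug A σ a) = aug A σ (aug A τ a) := by
  have h : A.ρ τ (A.ρ σ a) = A.ρ σ (A.ρ τ a) := by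
    rw [← Module.End.mul_apply, ← map_mul,
      mul_comm_of_exponent_two IsKleinFour.exponent_two τ σ, map_mul, Module.End.mul_apply]
  simp only [aug, LinearMap.sub_apply, LinearMap.id_apply, map_sub, h]
  abel

/-- Since `σ² = 1`, being fixed by `στ` means `σ a = τ a`. Thus `⟨στ⟩`-fixed vectors become the
kernel of `X - Y`, with no product term. -/
lemma aug_mul_eq_zero_iff (A : Rep.{w} k G) (σ τ : G) (a : A) :
    aug A (σ * τ) a = 0 ↔ aug A σ a = aug A τ a := by
  have h : ∀ b, A.ρ σ (A.ρ σ b) = b := fun b => by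
    rw [← Module.End.mul_apply, ← map_mul, IsKleinFour.mul_self, map_one, Module.End.one_apply]
  rw [← ρ_eq_self_iff, map_mul, Module.End.mul_apply]
  simp only [aug, LinearMap.sub_apply, LinearMap.id_apply, sub_left_inj]
  exact ⟨fun h1 => by rw [← h (A.ρ τ a), h1], fun h1 => by rw [← h1, h]⟩

variable [CharP k 2]

lemma add_self_eq_zero' (k : Type u) [Field k] [CharP k 2] {V : Type w} [AddCommGroup V]
    [Module k V] (a : V) : a + a = 0 := by
  rw [← two_smul k a, CharTwo.two_eq_zero, zero_smul]

lemma aug_aug (A : Rep.{w} k G) (g : G) (a : A) : aug A g (aug A g a) = 0 := by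
  have h : A.ρ g (A.ρ g a) = a := by
    rw [← Module.End.mul_apply, ← map_mul, IsKleinFour.mul_self, map_one, Module.End.one_apply]
  simp only [aug, LinearMap.sub_apply, LinearMap.id_apply, map_sub, h]
  have h1 := add_self_eq_zero' k a
  have h2 := add_self_eq_zero' k (A.ρ g a)
  calc a - A.ρ g a - (A.ρ g a - a) = (a + a) - (A.ρ g a + A.ρ g a) := by abel
    _ = 0 := by rw [h1, h2, sub_zero]

variable (hσ : σ ≠ 1) (hτ : τ ≠ 1) (hστ : σ ≠ τ)

/-- The homomorphism out of `Cover k T` with given values on the generators. -/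
noncomputable def coverDesc (L : T →ₗ[k] A) (y₁ y₂ y₃ : A) (h₁ : aug A σ y₁ = 0)
    (h₂ : aug A τ y₂ = 0) (h₃ : aug A σ y₃ = aug A τ y₃) :
    kleinRep hσ hτ hστ (coverPair k T) ⟶ A :=
  homOfComm hσ hτ hστ (coverLinear σ τ A L y₁ y₂ y₃)
    (fun v => by
      rw [Rep.of_ρ, kleinRepresentation_left, map_add, ρ_eq_add_aug]
      congr 1
      simp only [coverLinear, coverPair, LinearMap.coe_mk, AddHom.coe_mk, map_add, map_smul,
        aug_aug, ← aug_comm A σ τ, h₁, map_zero, smul_zero, zero_smul, add_zero, zero_add])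
    (fun v => by
      rw [Rep.of_ρ, kleinRepresentation_right, map_add, ρ_eq_add_aug]
      congr 1
      simp only [coverLinear, coverPair, LinearMap.coe_mk, AddHom.coe_mk, map_add, map_smul,
        aug_aug, aug_comm A σ τ, h₂, h₃, map_zero, smul_zero, zero_smul, add_zero, zero_add])

/-- Homomorphisms out of `Cover k T` are determined by their values on the generators. -/
lemma cover_hom_ext {f g : kleinRep hσ hτ hστ (coverPair k T) ⟶ A}
    (h : ∀ t, f.hom ((t, 0), (0, 0), (0, 0), (0, 0), (0, 0)) =
      g.hom ((t, 0), (0, 0), (0, 0), (0, 0), (0, 0)))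
    (h₁ : f.hom ((0, 0), (0, 0), (1, 0), (0, 0), (0, 0)) =
      g.hom ((0, 0), (0, 0), (1, 0), (0, 0), (0, 0)))
    (h₂ : f.hom ((0, 0), (0, 0), (0, 0), (1, 0), (0, 0)) =
      g.hom ((0, 0), (0, 0), (0, 0), (1, 0), (0, 0)))
    (h₃ : f.hom ((0, 0), (0, 0), (0, 0), (0, 0), (1, 0)) =
      g.hom ((0, 0), (0, 0), (0, 0), (0, 0), (1, 0))) : f = g := by
  -- The equalizer is stable under `X` and `Y`, so it contains everything obtained from the
  -- generators by these operators.
  let E : Submodule k (Cover k T) := LinearMap.eqLocus f.hom.toLinearMap g.hom.toLinearMap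
  have hX : ∀ v ∈ E, (coverPair k T).X v ∈ E := fun v hv => by
    change f.hom _ = g.hom _
    rw [hom_kleinRep_left, hom_kleinRep_left, show f.hom v = g.hom v from hv]
  have hY : ∀ v ∈ E, (coverPair k T).Y v ∈ E := fun v hv => by
    change f.hom _ = g.hom _
    rw [hom_kleinRep_right, hom_kleinRep_right, show f.hom v = g.hom v from hv]
  refine Rep.hom_ext (Representation.IntertwiningMap.ext (LinearMap.ext ?_))
  rintro ⟨⟨e, x⟩, ⟨y, z⟩, ⟨u₁, w₁⟩, ⟨u₂, w₂⟩, ⟨u₃, w₃⟩⟩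
  change _ ∈ E
  have key := E.add_mem (E.add_mem (E.add_mem (E.add_mem (h e) (hX _ (h x)))
    (E.add_mem (hY _ (h y)) (hX _ (hY _ (h z)))))
    (E.add_mem (E.smul_mem u₁ h₁) (E.smul_mem w₁ (hY _ h₁))))
    (E.add_mem (E.add_mem (E.smul_mem u₂ h₂) (E.smul_mem w₂ (hX _ h₂)))
    (E.add_mem (E.smul_mem u₃ h₃) (E.smul_mem w₃ (hX _ h₃))))
  convert key using 1
  simp [coverPair]

lemma aug_cover (g : G) (v : Cover k T) : aug (kleinRep hσ hτ hστ (coverPair k T)) g v =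
    kleinRepresentation hσ hτ hστ (coverPair k T) g v - v := rfl

/-- Homomorphisms out of `Cover k T` are given by their values on the generators. -/
noncomputable def coverHomEquiv (A : Rep.{u} k G) :
    (kleinRep hσ hτ hστ (coverPair k T) ⟶ A) ≃ₗ[k]
      (T →ₗ[k] A) × LinearMap.ker (aug A σ) × LinearMap.ker (aug A τ) ×
        LinearMap.ker (aug A σ - aug A τ) where
  toFun f := (f.hom.toLinearMap ∘ₗ LinearMap.inl k _ _ ∘ₗ LinearMap.inl k _ _,
    ⟨f.hom ((0, 0), (0, 0), (1, 0), (0, 0), (0, 0)), by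
      rw [LinearMap.mem_ker, ← hom_aug, aug_cover, kleinRepresentation_left, add_sub_cancel_left]
      exact map_zero f.hom⟩,
    ⟨f.hom ((0, 0), (0, 0), (0, 0), (1, 0), (0, 0)), by
      rw [LinearMap.mem_ker, ← hom_aug, aug_cover, kleinRepresentation_right, add_sub_cancel_left]
      exact map_zero f.hom⟩,
    ⟨f.hom ((0, 0), (0, 0), (0, 0), (0, 0), (1, 0)), by
      rw [LinearMap.mem_ker, LinearMap.sub_apply, ← hom_aug, ← hom_aug, aug_cover, aug_cover,
        kleinRepresentation_left, kleinRepresentation_right, add_sub_cancel_left,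
        add_sub_cancel_left]
      exact sub_self _⟩)
  map_add' f g := rfl
  map_smul' c f := rfl
  invFun p := coverDesc hσ hτ hστ p.1 p.2.1 p.2.2.1 p.2.2.2 p.2.1.2 p.2.2.1.2
    (sub_eq_zero.1 p.2.2.2.2)
  left_inv f := by
    apply cover_hom_ext
    · exact coverLinear_one _ _ _ _
    · exact coverLinear_left _ _ _ _
    · exact coverLinear_right _ _ _ _
    · exact coverLinear_mul _ _ _ _
  right_inv p := by
    obtain ⟨L, ⟨y₁, h₁⟩, ⟨y₂, h₂⟩, ⟨y₃, h₃⟩⟩ := p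
    refine Prod.ext (LinearMap.ext fun t => ?_) (Prod.ext (Subtype.ext ?_)
      (Prod.ext (Subtype.ext ?_) (Subtype.ext ?_)))
    · exact coverLinear_one _ _ _ _ t
    · exact coverLinear_left _ _ _ _
    · exact coverLinear_right _ _ _ _
    · exact coverLinear_mul _ _ _ _

/-- A homomorphism out of the cover amounts to a linear map on `T` and one vector fixed by each of
`⟨σ⟩`, `⟨τ⟩`, `⟨στ⟩`. The linear map lifts through any surjection; an `H`-linear section carries
`H`-fixed vectors to `H`-fixed vectors, so the other data lift through a χ-split one. -/
lemma isRelProjective_cover :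
    IsRelProjective (properSubgroups σ τ) (kleinRep hσ hτ hστ (coverPair k T)) := by
  intro A B φ j hj hsp
  obtain ⟨s, hs⟩ := LinearMap.exists_rightInverse_of_surjective j.hom.toLinearMap
    (LinearMap.range_eq_top.2 hj)
  have lift : ∀ g, Subgroup.zpowers g ∈ properSubgroups σ τ → ∀ b, aug B g b = 0 →
      ∃ a, j.hom a = b ∧ aug A g a = 0 := by
    intro g hg b hb
    obtain ⟨r, hr, hr'⟩ := (hsp _ hg).exists_section hj
    refine ⟨r b, hr b, ?_⟩
    rw [← ρ_eq_self_iff] at hb ⊢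
    rw [← hr' g (Subgroup.mem_zpowers g), hb]
  let p := coverHomEquiv hσ hτ hστ B φ
  obtain ⟨y₁, e₁, h₁⟩ := lift σ (Or.inl rfl) p.2.1 p.2.1.2
  obtain ⟨y₂, e₂, h₂⟩ := lift τ (Or.inr (Or.inl rfl)) p.2.2.1 p.2.2.1.2
  obtain ⟨y₃, e₃, h₃⟩ := lift (σ * τ) (Or.inr (Or.inr rfl)) p.2.2.2
    ((aug_mul_eq_zero_iff B σ τ _).2 (sub_eq_zero.1 p.2.2.2.2))
  refine ⟨(coverHomEquiv hσ hτ hστ A).symm (s ∘ₗ p.1, ⟨y₁, h₁⟩, ⟨y₂, h₂⟩,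
    ⟨y₃, sub_eq_zero.2 ((aug_mul_eq_zero_iff A σ τ _).1 h₃)⟩), ?_⟩
  have hs' : ∀ b, j.hom (s b) = b := fun b => LinearMap.congr_fun hs b
  apply cover_hom_ext
  · exact fun t => (congrArg j.hom (coverLinear_one _ _ _ _ t)).trans (hs' _)
  · exact (congrArg j.hom (coverLinear_left _ _ _ _)).trans e₁
  · exact (congrArg j.hom (coverLinear_right _ _ _ _)).trans e₂
  · exact (congrArg j.hom (coverLinear_mul _ _ _ _)).trans e₃

end KleinFour

/-! ### Polynomial coordinates, the modules `V_{-(2m+1)}`, and division by `1 + t`. -/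

section KleinFour

variable {k : Type u} [Field k]

section Coordinates

/-- Prepending a zero coordinate: multiplication by `t` on the coefficients of polynomials. -/
def consZero (k : Type u) [Field k] (m : ℕ) : (Fin m → k) →ₗ[k] (Fin (m + 1) → k) where
  toFun g := Fin.cons 0 g
  map_add' _ _ := by funext j; cases j using Fin.cases <;> simp
  map_smul' _ _ := by funext j; cases j using Fin.cases <;> simp

/-- Appending a zero coordinate: the inclusion on the coefficients of polynomials. -/
def snocZero (k : Type u) [Field k] (m : ℕ) : (Fin m → k) →ₗ[k] (Fin (m + 1) → k) where
  toFun g := Fin.snoc g 0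
  map_add' _ _ := by funext j; cases j using Fin.lastCases <;> simp
  map_smul' _ _ := by funext j; cases j using Fin.lastCases <;> simp

/-- The vectors supported at the first coordinate. -/
def botCoord (k : Type u) [Field k] (m : ℕ) : k →ₗ[k] (Fin (m + 1) → k) where
  toFun a := Fin.cons a 0
  map_add' _ _ := by funext j; cases j using Fin.cases <;> simp
  map_smul' _ _ := by funext j; cases j using Fin.cases <;> simp

/-- The vectors supported at the last coordinate. -/
def topCoord (k : Type u) [Field k] (m : ℕ) : k →ₗ[k] (Fin (m + 1) → k) where
  toFun a := Fin.snoc 0 a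
  map_add' _ _ := by funext j; cases j using Fin.lastCases <;> simp
  map_smul' _ _ := by funext j; cases j using Fin.lastCases <;> simp

variable {m : ℕ} (g : Fin m → k) (a : k) (j : Fin m)

@[simp] lemma consZero_zero : consZero k m g 0 = 0 := rfl
@[simp] lemma consZero_succ : consZero k m g j.succ = g j := rfl
@[simp] lemma snocZero_last : snocZero k m g (Fin.last m) = 0 := by simp [snocZero]
@[simp] lemma snocZero_castSucc : snocZero k m g j.castSucc = g j := by simp [snocZero]
@[simp] lemma botCoord_zero : botCoord k m a 0 = a := rfl
@[simp] lemma botCoord_succ : botCoord k m a j.succ = 0 := rfl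
@[simp] lemma topCoord_last : topCoord k m a (Fin.last m) = a := by simp [topCoord]
@[simp] lemma topCoord_castSucc : topCoord k m a j.castSucc = 0 := by simp [topCoord]

lemma snocZero_botCoord : snocZero k (m + 1) (botCoord k m a) = botCoord k (m + 1) a := by
  funext j
  cases j using Fin.lastCases with
  | last => rw [snocZero_last, ← Fin.succ_last, botCoord_succ]
  | cast j =>
    rw [snocZero_castSucc]
    cases j using Fin.cases <;> rfl

lemma snocZero_consZero :
    snocZero k (m + 1) (consZero k m g) = consZero k (m + 1) (snocZero k m g) := by
  funext j
  cases j using Fin.lastCases with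
  | last => rw [snocZero_last, ← Fin.succ_last, consZero_succ, snocZero_last]
  | cast j =>
    rw [snocZero_castSucc]
    cases j using Fin.cases with
    | zero => rfl
    | succ j => rw [← Fin.succ_castSucc, consZero_succ, consZero_succ, snocZero_castSucc]

lemma botCoord_add_consZero (d : Fin (m + 1) → k) :
    botCoord k m (d 0) + consZero k m (fun j => d j.succ) = d := by
  funext j; cases j using Fin.cases <;> simp

lemma snocZero_add_topCoord (d : Fin (m + 1) → k) :
    snocZero k m (fun j => d j.castSucc) + topCoord k m (d (Fin.last m)) = d := by
  funext j; cases j using Fin.lastCases <;> simp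

end Coordinates

/-- The space underlying the module `V_{-(2m+1)}` with basis `c₁, …, c_m, d₀, …, d_m`. -/
abbrev NegOdd (k : Type u) (m : ℕ) : Type u := (Fin m → k) × (Fin (m + 1) → k)

/-- The operators `X cⱼ = dⱼ`, `Y cⱼ = dⱼ₋₁`, `X dⱼ = Y dⱼ = 0`. -/
def negOddPair (k : Type u) [Field k] (m : ℕ) : SqZeroPair k (NegOdd k m) where
  X := LinearMap.inr k _ _ ∘ₗ consZero k m ∘ₗ LinearMap.fst k _ _
  Y := LinearMap.inr k _ _ ∘ₗ snocZero k m ∘ₗ LinearMap.fst k _ _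
  X_mul_X := LinearMap.ext fun _ => Prod.ext rfl (map_zero (consZero k m))
  Y_mul_Y := LinearMap.ext fun _ => Prod.ext rfl (map_zero (snocZero k m))
  X_mul_Y := LinearMap.ext fun _ => Prod.ext rfl
    ((map_zero (consZero k m)).trans (map_zero (snocZero k m)).symm)

lemma negOddPair_X (m : ℕ) (v : NegOdd k m) : (negOddPair k m).X v = (0, consZero k m v.1) := rfl

lemma negOddPair_Y (m : ℕ) (v : NegOdd k m) : (negOddPair k m).Y v = (0, snocZero k m v.1) := rfl

/-- Multiplication of polynomials `g` by `1 + t`, plus a constant `α`, in coordinates. -/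
def mulOneAdd (k : Type u) [Field k] (m : ℕ) : k × (Fin m → k) →ₗ[k] (Fin (m + 1) → k) :=
  (botCoord k m).coprod (consZero k m + snocZero k m)

lemma mulOneAdd_apply (m : ℕ) (p : k × (Fin m → k)) : mulOneAdd k m p =
    botCoord k m p.1 + (consZero k m p.2 + snocZero k m p.2) := rfl

variable [CharP k 2]

lemma mulOneAdd_injective (m : ℕ) : Function.Injective (mulOneAdd k m) := by
  rw [← LinearMap.ker_eq_bot, LinearMap.ker_eq_bot']
  rintro ⟨α, g⟩ h
  rw [mulOneAdd_apply] at h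
  -- Summing coordinates evaluates at `t = 1`, which kills `(1 + t) g` in characteristic two and
  -- leaves `α = 0`.
  have hs := congrArg (fun f => ∑ j, f j) h
  simp only [Pi.add_apply, Finset.sum_add_distrib, Fin.sum_univ_succ (botCoord k m α),
    Fin.sum_univ_succ (consZero k m g), Fin.sum_univ_castSucc (snocZero k m g)] at hs
  simp only [botCoord_zero, botCoord_succ, Finset.sum_const_zero, add_zero, consZero_zero,
    consZero_succ, zero_add, snocZero_castSucc, snocZero_last, Pi.zero_apply,
    CharTwo.add_self_eq_zero] at hs
  subst hs
  dsimp only at h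
  -- Now `(1 + t) g = 0`; compare coefficients from the lowest degree upwards.
  have hg : ∀ (i : ℕ) (hi : i < m), g ⟨i, hi⟩ = 0 := by
    intro i
    induction i with
    | zero =>
      intro hi
      have := congrFun h (Fin.castSucc ⟨0, hi⟩)
      rw [map_zero, zero_add, Pi.add_apply, snocZero_castSucc] at this
      exact (zero_add _).symm.trans this
    | succ i ih =>
      intro hi
      have := congrFun h (Fin.castSucc ⟨i + 1, hi⟩)
      rw [map_zero, zero_add, Pi.add_apply, snocZero_castSucc,
        show (Fin.castSucc ⟨i + 1, hi⟩ : Fin (m + 1)) = Fin.succ ⟨i, by omega⟩ from rfl,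
        consZero_succ, ih, zero_add] at this
      exact this
  exact Prod.ext rfl (funext fun j => hg j j.2)

/-- Division with remainder by `1 + t`, in coordinates, inverse to `mulOneAdd`. -/
noncomputable def mulOneAddEquiv (k : Type u) [Field k] [CharP k 2] (m : ℕ) :
    (k × (Fin m → k)) ≃ₗ[k] (Fin (m + 1) → k) :=
  LinearEquiv.ofInjectiveOfFinrankEq (mulOneAdd k m) (mulOneAdd_injective m)
    (by simp [add_comm])

lemma mulOneAddEquiv_apply (m : ℕ) (p : k × (Fin m → k)) : mulOneAddEquiv k m p =
    botCoord k m p.1 + (consZero k m p.2 + snocZero k m p.2) := rfl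

lemma mulOneAddEquiv_symm_snocZero (m : ℕ) (c : Fin (m + 1) → k) :
    (mulOneAddEquiv k (m + 1)).symm (snocZero k (m + 1) c) =
      (((mulOneAddEquiv k m).symm c).1, snocZero k m ((mulOneAddEquiv k m).symm c).2) := by
  obtain ⟨p, rfl⟩ := (mulOneAddEquiv k m).surjective c
  rw [LinearEquiv.symm_apply_eq, LinearEquiv.symm_apply_apply]
  simp only [mulOneAddEquiv_apply, map_add, snocZero_botCoord, snocZero_consZero]

/-- In characteristic two, `t (α + (1 + t) q) = α + (1 + t) (t q + α)`. -/
lemma mulOneAddEquiv_symm_consZero (m : ℕ) (c : Fin (m + 1) → k) :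
    (mulOneAddEquiv k (m + 1)).symm (consZero k (m + 1) c) =
      (((mulOneAddEquiv k m).symm c).1, consZero k m ((mulOneAddEquiv k m).symm c).2 +
        botCoord k m ((mulOneAddEquiv k m).symm c).1) := by
  obtain ⟨p, rfl⟩ := (mulOneAddEquiv k m).surjective c
  rw [LinearEquiv.symm_apply_eq, LinearEquiv.symm_apply_apply]
  simp only [mulOneAddEquiv_apply, map_add, snocZero_botCoord, snocZero_consZero]
  have h := add_self_eq_zero' k (botCoord k (m + 1) p.1)
  rw [← sub_eq_zero, ← neg_eq_zero]
  refine Eq.trans ?_ h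
  abel

end KleinFour

/-! ### The short exact sequences linking `V_{-(2m+1)}` and `V_{-(2m+5)}`. -/

section KleinFour

variable {k : Type u} [Field k]

/-- The underlying linear map of the relatively projective cover of `V_{-(2m+1)}`. -/
def coverProj (k : Type u) [Field k] (m : ℕ) : Cover k (Fin m → k) →ₗ[k] NegOdd k m where
  toFun v := (v.1.1, consZero k m v.1.2 + snocZero k m v.2.1.1 +
    (botCoord k m (v.2.2.1.1 + v.2.2.2.2.1) + topCoord k m v.2.2.2.1.1))
  map_add' v w := by
    refine Prod.ext rfl ?_
    simp only [Prod.fst_add, Prod.snd_add, map_add]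
    abel
  map_smul' r v := by
    refine Prod.ext rfl ?_
    simp only [Prod.smul_fst, Prod.smul_snd, map_smul, smul_add, RingHom.id_apply, map_add]

lemma coverProj_apply (m : ℕ) (v : Cover k (Fin m → k)) : coverProj k m v =
    (v.1.1, consZero k m v.1.2 + snocZero k m v.2.1.1 +
      (botCoord k m (v.2.2.1.1 + v.2.2.2.2.1) + topCoord k m v.2.2.2.1.1)) := rfl

lemma coverProj_surjective (m : ℕ) : Function.Surjective (coverProj k m) := by
  rintro ⟨c, d⟩
  refine ⟨((c, fun j => d j.succ), (0, 0), (d 0, 0), (0, 0), (0, 0)), ?_⟩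
  rw [coverProj_apply]
  refine Prod.ext rfl ?_
  simp only [map_zero, add_zero]
  exact (add_comm _ _).trans (botCoord_add_consZero d)

/-- The kernel of the relatively projective cover of `V_{-(2m+1)}`, in the coordinates given by
division with remainder by `1 + t`. -/
def syzygyAux (k : Type u) [Field k] (m : ℕ) :
    (k × (Fin (m + 1) → k)) × (k × (Fin (m + 2) → k)) →ₗ[k] Cover k (Fin m → k) where
  toFun p := ((0, fun j => p.1.2 j.succ),
    (fun j => p.1.2 j.castSucc, fun j => p.2.2 j.castSucc.succ),
    (p.1.1 + p.1.2 0, p.2.1 + p.2.2 0),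
    (p.1.2 (Fin.last m), p.2.2 (Fin.last (m + 1))), p.1.1, p.2.1)
  map_add' p q := by
    refine Prod.ext (Prod.ext (zero_add 0).symm rfl) (Prod.ext rfl (Prod.ext (Prod.ext ?_ ?_) rfl))
    · exact add_add_add_comm _ _ _ _
    · exact add_add_add_comm _ _ _ _
  map_smul' r p := by
    refine Prod.ext (Prod.ext (smul_zero r).symm rfl)
      (Prod.ext rfl (Prod.ext (Prod.ext ?_ ?_) rfl))
    · exact (mul_add _ _ _).symm
    · exact (mul_add _ _ _).symm

lemma syzygyAux_apply (m : ℕ) (p : (k × (Fin (m + 1) → k)) × (k × (Fin (m + 2) → k))) :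
    syzygyAux k m p = ((0, fun j => p.1.2 j.succ),
    (fun j => p.1.2 j.castSucc, fun j => p.2.2 j.castSucc.succ),
    (p.1.1 + p.1.2 0, p.2.1 + p.2.2 0),
    (p.1.2 (Fin.last m), p.2.2 (Fin.last (m + 1))), p.1.1, p.2.1) := rfl

lemma syzygyAux_injective (m : ℕ) : Function.Injective (syzygyAux k m) := by
  rw [← LinearMap.ker_eq_bot, LinearMap.ker_eq_bot']
  rintro ⟨⟨α, q⟩, ⟨β, s⟩⟩ h
  rw [syzygyAux_apply] at h
  simp only [Prod.mk_eq_zero] at h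
  obtain ⟨⟨-, h₁⟩, ⟨-, h₂⟩, ⟨h₃, h₄⟩, ⟨-, h₅⟩, rfl, rfl⟩ := h
  rw [zero_add] at h₃ h₄
  have hq : q = 0 := by
    funext j
    cases j using Fin.cases with
    | zero => exact h₃
    | succ j => exact congrFun h₁ j
  have hs : s = 0 := by
    funext j
    cases j using Fin.cases with
    | zero => exact h₄
    | succ j =>
      cases j using Fin.lastCases with
      | last => exact h₅
      | cast j => exact congrFun h₂ j
  rw [hq, hs]
  rfl

variable [CharP k 2]

/-- The underlying linear map of the embedding of `V_{-(2(m+2)+1)}` as the kernel of the relatively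
projective cover of `V_{-(2m+1)}`. -/
noncomputable def syzygyIncl (k : Type u) [Field k] [CharP k 2] (m : ℕ) :
    NegOdd k (m + 2) →ₗ[k] Cover k (Fin m → k) :=
  syzygyAux k m ∘ₗ ((mulOneAddEquiv k (m + 1)).symm.toLinearMap.prodMap
    (mulOneAddEquiv k (m + 2)).symm.toLinearMap)

lemma syzygyIncl_apply (m : ℕ) (v : NegOdd k (m + 2)) : syzygyIncl k m v =
    syzygyAux k m ((mulOneAddEquiv k (m + 1)).symm v.1, (mulOneAddEquiv k (m + 2)).symm v.2) := rfl

lemma syzygyIncl_injective (m : ℕ) : Function.Injective (syzygyIncl k m) :=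
  (syzygyAux_injective m).comp ((mulOneAddEquiv k (m + 1)).symm.injective.prodMap
    (mulOneAddEquiv k (m + 2)).symm.injective)

/-- With `c = α + (1 + t) q`, multiplication by `t` turns the quotient into `t q + α`. Its constant
term `α` cancels the remainder in the second coordinate of `k[G/⟨σ⟩]`, as it must because `X` acts
there by zero. -/
lemma syzygyIncl_X (m : ℕ) (v : NegOdd k (m + 2)) :
    syzygyIncl k m ((negOddPair k (m + 2)).X v) = (coverPair k _).X (syzygyIncl k m v) := by
  rw [syzygyIncl_apply, syzygyIncl_apply, negOddPair_X, mulOneAddEquiv_symm_consZero]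
  obtain ⟨⟨α, q⟩, h⟩ : ∃ p, (mulOneAddEquiv k (m + 1)).symm v.1 = p := ⟨_, rfl⟩
  simp only [h, map_zero, syzygyAux_apply]
  refine Prod.ext rfl (Prod.ext (Prod.ext rfl ?_) (Prod.ext (Prod.ext ?_ ?_) (Prod.ext
    (Prod.ext rfl ?_) rfl)))
  · funext j
    simp [coverPair]
  · simp [coverPair]
  · simp [coverPair, CharTwo.add_self_eq_zero]
  · simp only [← Fin.succ_last, Pi.add_apply, consZero_succ, botCoord_succ, add_zero]
    rfl

lemma syzygyIncl_Y (m : ℕ) (v : NegOdd k (m + 2)) :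
    syzygyIncl k m ((negOddPair k (m + 2)).Y v) = (coverPair k _).Y (syzygyIncl k m v) := by
  rw [syzygyIncl_apply, syzygyIncl_apply, negOddPair_Y, mulOneAddEquiv_symm_snocZero]
  obtain ⟨⟨α, q⟩, h⟩ : ∃ p, (mulOneAddEquiv k (m + 1)).symm v.1 = p := ⟨_, rfl⟩
  simp only [h, map_zero, syzygyAux_apply]
  refine Prod.ext rfl (Prod.ext (Prod.ext rfl ?_) (Prod.ext (Prod.ext ?_ ?_) (Prod.ext
    (Prod.ext rfl ?_) rfl)))
  · funext j
    simp only [Fin.succ_castSucc, snocZero_castSucc]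
    rfl
  · simp [coverPair]
  · simp only [← Fin.castSucc_zero, snocZero_castSucc]
    rfl
  · simp [coverPair]

lemma coverProj_syzygyIncl (m : ℕ) (v : NegOdd k (m + 2)) :
    coverProj k m (syzygyIncl k m v) = 0 := by
  rw [syzygyIncl_apply, coverProj_apply, syzygyAux_apply]
  obtain ⟨⟨α, q⟩, h⟩ : ∃ p, (mulOneAddEquiv k (m + 1)).symm v.1 = p := ⟨_, rfl⟩
  refine Prod.ext rfl ?_
  simp only [h]
  -- The copies of `α` from `k[G/⟨σ⟩]` and `k[G/⟨στ⟩]` cancel. What remains is `q + q`, once split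
  -- off at its constant term and once at its leading term.
  rw [show α + q 0 + α = q 0 by rw [add_comm, ← add_assoc, CharTwo.add_self_eq_zero, zero_add]]
  have h₁ := botCoord_add_consZero q
  have h₂ := snocZero_add_topCoord q
  refine Eq.trans ?_ (add_self_eq_zero' k q)
  conv_rhs => rw [← h₁]
  conv_rhs => arg 2; rw [h₁, ← h₂]
  abel

/-- One inclusion and a dimension count: `(4m + 6) - (2m + 1) = 2(m + 2) + 1`. -/
lemma exact_syzygyIncl_coverProj (m : ℕ) :
    Function.Exact (syzygyIncl k m) (coverProj k m) := by
  rw [LinearMap.exact_iff]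
  symm
  apply Submodule.eq_of_le_of_finrank_eq
  · rintro _ ⟨v, rfl⟩
    exact coverProj_syzygyIncl m v
  · rw [LinearMap.finrank_range_of_inj (syzygyIncl_injective m)]
    have h := LinearMap.finrank_range_add_finrank_ker (coverProj k m)
    rw [LinearMap.range_eq_top.2 (coverProj_surjective m), finrank_top] at h
    simp at h ⊢
    omega

variable {G : Type v} [Group G] [IsKleinFour G] {σ τ : G}
variable (hσ : σ ≠ 1) (hτ : τ ≠ 1) (hστ : σ ≠ τ)

/-- The module `V_{-(2m+1)}`. -/
noncomputable abbrev negOddModule (m : ℕ) : Rep.{u} k G := kleinRep hσ hτ hστ (negOddPair k m)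

/-- The homomorphism `coverProj`. -/
noncomputable def coverProjHom (m : ℕ) :
    kleinRep hσ hτ hστ (coverPair k (Fin m → k)) ⟶ negOddModule hσ hτ hστ m :=
  kleinHom hσ hτ hστ (coverProj k m)
    (fun v => by
      simp [coverProj_apply, negOddPair_X, coverPair])
    (fun v => by
      simp [coverProj_apply, negOddPair_Y, coverPair])

/-- The homomorphism `syzygyIncl`. -/
noncomputable def syzygyInclHom (m : ℕ) :
    negOddModule hσ hτ hστ (m + 2) ⟶ kleinRep hσ hτ hστ (coverPair k (Fin m → k)) :=
  kleinHom hσ hτ hστ (syzygyIncl k m) (syzygyIncl_X m) (syzygyIncl_Y m)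

/-- The section of `coverProj` which is linear over `⟨σ⟩`. -/
def coverSecLeft (k : Type u) [Field k] (m : ℕ) : NegOdd k m →ₗ[k] Cover k (Fin m → k) where
  toFun v := ((v.1, fun j => v.2 j.succ), (0, 0), (v.2 0, 0), (0, 0), (0, 0))
  map_add' _ _ := by simp; rfl
  map_smul' _ _ := by simp; rfl

/-- The section of `coverProj` which is linear over `⟨τ⟩`. -/
def coverSecRight (k : Type u) [Field k] (m : ℕ) : NegOdd k m →ₗ[k] Cover k (Fin m → k) where
  toFun v := ((v.1, 0), (fun j => v.2 j.castSucc, 0), (0, 0), (v.2 (Fin.last m), 0), (0, 0))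
  map_add' _ _ := by simp; rfl
  map_smul' _ _ := by simp; rfl

/-- The section of `coverProj` which is linear over `⟨στ⟩`. -/
noncomputable def coverSecMul (k : Type u) [Field k] [CharP k 2] (m : ℕ) :
    NegOdd k m →ₗ[k] Cover k (Fin m → k) where
  toFun v := ((v.1, ((mulOneAddEquiv k m).symm v.2).2),
    (((mulOneAddEquiv k m).symm v.2).2, ((mulOneAddEquiv k m).symm v.2).2), (0, 0), (0, 0),
    (((mulOneAddEquiv k m).symm v.2).1, 0))
  map_add' _ _ := by simp
  map_smul' _ _ := by simp

lemma exists_section_of_comm (m : ℕ) (g : G) (s : NegOdd k m →ₗ[k] Cover k (Fin m → k))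
    (h₁ : ∀ v, coverProj k m (s v) = v)
    (h₂ : ∀ v, s (kleinRepresentation hσ hτ hστ (negOddPair k m) g v) =
      kleinRepresentation hσ hτ hστ (coverPair k (Fin m → k)) g (s v)) :
    ∃ s : negOddModule hσ hτ hστ m →ₗ[k] kleinRep hσ hτ hστ (coverPair k (Fin m → k)),
      (∀ b, (coverProjHom hσ hτ hστ m).hom (s b) = b) ∧
      ∀ h ∈ Subgroup.zpowers g, ∀ b, s ((negOddModule hσ hτ hστ m).ρ h b) =
        (kleinRep hσ hτ hστ (coverPair k (Fin m → k))).ρ h (s b) :=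
  ⟨s, h₁, fun _ hh b => comm_of_mem_zpowers (A := kleinRep hσ hτ hστ (coverPair k (Fin m → k)))
    (B := negOddModule hσ hτ hστ m) s h₂ hh b⟩

/-- On `V_{-(2m+1)}` the product `XY` vanishes, so `στ` adds `(1 + t) c` to `d`: the quotient grows
by `c` and the remainder is unchanged. In the cover `XY` does not vanish; storing the quotient `q`
in the `X`, `Y` and `XY` coordinates makes the last one grow by `q + q + c = c` as well. -/
lemma coverSecMul_comm (m : ℕ) (v : NegOdd k m) :
    coverSecMul k m (kleinRepresentation hσ hτ hστ (negOddPair k m) (σ * τ) v) =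
      kleinRepresentation hσ hτ hστ (coverPair k (Fin m → k)) (σ * τ) (coverSecMul k m v) := by
  obtain ⟨c, d⟩ := v
  have hD : mulOneAddEquiv k m (0, c) = consZero k m c + snocZero k m c := by
    rw [mulOneAddEquiv_apply, map_zero, zero_add]
  have hv : kleinRepresentation hσ hτ hστ (negOddPair k m) (σ * τ) (c, d) =
      (c, d + mulOneAddEquiv k m (0, c)) := by
    rw [map_mul, Module.End.mul_apply, kleinRepresentation_right, kleinRepresentation_left,
      negOddPair_X, negOddPair_Y, hD]
    refine Prod.ext ?_ ?_
    · simp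
    · simp only [Prod.snd_add, Prod.fst_add, add_zero]
      abel
  rw [hv, map_mul, Module.End.mul_apply, kleinRepresentation_right, kleinRepresentation_left]
  simp only [coverSecMul, coverPair, LinearMap.coe_mk, AddHom.coe_mk, map_add,
    LinearEquiv.symm_apply_apply, Prod.fst_add, Prod.snd_add, add_zero, zero_add,
    Prod.mk_add_mk]
  refine Prod.ext rfl (Prod.ext (Prod.ext rfl ?_) (Prod.ext rfl (Prod.ext rfl (Prod.ext rfl ?_))))
  · change _ = _ + _ + _
    rw [add_self_eq_zero' k, zero_add]
  · change _ = _ + _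
    rw [CharTwo.add_self_eq_zero]

/-- The relatively projective cover of `V_{-(2m+1)}` splits over the three proper subgroups. -/
lemma exists_section_coverProjHom (m : ℕ) (H : Subgroup G) (hH : H ∈ properSubgroups σ τ) :
    ∃ s : negOddModule hσ hτ hστ m →ₗ[k] kleinRep hσ hτ hστ (coverPair k (Fin m → k)),
      (∀ b, (coverProjHom hσ hτ hστ m).hom (s b) = b) ∧
      ∀ h ∈ H, ∀ b, s ((negOddModule hσ hτ hστ m).ρ h b) =
        (kleinRep hσ hτ hστ (coverPair k (Fin m → k))).ρ h (s b) := by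
  rcases hH with rfl | rfl | rfl
  · refine exists_section_of_comm hσ hτ hστ m σ (coverSecLeft k m) (fun v => ?_) (fun v => ?_)
    · refine Prod.ext rfl (Eq.trans ?_ (botCoord_add_consZero v.2))
      simp [coverProj_apply, coverSecLeft, add_comm]
    · simp [coverSecLeft, negOddPair_X, coverPair]
      rfl
  · refine exists_section_of_comm hσ hτ hστ m τ (coverSecRight k m) (fun v => ?_) (fun v => ?_)
    · refine Prod.ext rfl (Eq.trans ?_ (snocZero_add_topCoord v.2))
      simp [coverProj_apply, coverSecRight]
    · simp [coverSecRight, negOddPair_Y, coverPair]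
      rfl
  · refine exists_section_of_comm hσ hτ hστ m (σ * τ) (coverSecMul k m) (fun v => ?_)
      (coverSecMul_comm hσ hτ hστ m)
    refine Prod.ext rfl (Eq.trans ?_ ((mulOneAddEquiv k m).apply_symm_apply v.2))
    rw [mulOneAddEquiv_apply, add_comm (botCoord k m _)]
    simp [coverProj_apply, coverSecMul]

end KleinFour

/-! ### Homomorphisms from `V_{-(2m+1)}` to `V_{2n+1}` as Hankel data. -/

section KleinFour

variable {k : Type u} [Field k]

/-- The space underlying `V_{2n+1}`. -/
abbrev Odd (k : Type u) (n : ℕ) : Type u := (Fin (n + 1) → k) × (Fin n → k)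

/-- The operators on `V_{2n+1}`. -/
def oddPair (k : Type u) [Field k] (n : ℕ) : SqZeroPair k (Odd k n) where
  X := opX k n
  Y := opY k n
  X_mul_X := opX_mul_opX n
  Y_mul_Y := opY_mul_opY n
  X_mul_Y := opX_mul_opY n

/-- The homomorphism `V_{-(2m+1)} ⟶ V_{2n+1}` given by a Hankel form on the tops and an arbitrary
map from the top to the socle. -/
def hankelLinear (m n : ℕ) (g : Fin m → Fin n → k) (h : Fin (m + n) → k) :
    NegOdd k m →ₗ[k] Odd k n where
  toFun v := (fun l => ∑ j : Fin m, v.1 j * h ⟨j + l, by omega⟩,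
    fun l => ∑ j : Fin m, v.1 j * g j l + ∑ j : Fin (m + 1), v.2 j * h ⟨j + l, by omega⟩)
  map_add' v w := by
    refine Prod.ext (funext fun l => ?_) (funext fun l => ?_)
    · simp [add_mul, Finset.sum_add_distrib]
    · simp only [Prod.fst_add, Prod.snd_add, Pi.add_apply, add_mul, Finset.sum_add_distrib]
      abel
  map_smul' r v := by
    refine Prod.ext (funext fun l => ?_) (funext fun l => ?_) <;>
    simp [Finset.mul_sum, mul_add, mul_assoc]

lemma hankelLinear_X (m n : ℕ) (g : Fin m → Fin n → k) (h : Fin (m + n) → k) (v : NegOdd k m) :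
    hankelLinear m n g h ((negOddPair k m).X v) = (oddPair k n).X (hankelLinear m n g h v) := by
  refine Prod.ext (funext fun l => ?_) (funext fun l => ?_)
  · simp [hankelLinear, negOddPair_X, oddPair, opX]
  · simp [hankelLinear, negOddPair_X, oddPair, opX, Fin.sum_univ_succ, add_assoc, add_comm 1]

lemma hankelLinear_Y (m n : ℕ) (g : Fin m → Fin n → k) (h : Fin (m + n) → k) (v : NegOdd k m) :
    hankelLinear m n g h ((negOddPair k m).Y v) = (oddPair k n).Y (hankelLinear m n g h v) := by
  refine Prod.ext (funext fun l => ?_) (funext fun l => ?_)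
  · simp [hankelLinear, negOddPair_Y, oddPair, opY]
  · simp [hankelLinear, negOddPair_Y, oddPair, opY, Fin.sum_univ_castSucc]

lemma hankelLinear_single (m n : ℕ) (g : Fin m → Fin n → k) (h : Fin (m + n) → k) (j : Fin m) :
    hankelLinear m n g h (Pi.single j 1, 0) = (fun l : Fin (n + 1) => h ⟨j + l, by omega⟩, g j) := by
  refine Prod.ext (funext fun l => ?_) (funext fun l => ?_) <;>
  simp [hankelLinear, Pi.single_apply]

lemma consZero_single {m : ℕ} (j : Fin m) :
    consZero k m (Pi.single j 1) = Pi.single j.succ 1 := by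
  funext i
  cases i using Fin.cases with
  | zero => simp [(Fin.succ_ne_zero j).symm]
  | succ i => simp [Pi.single_apply]

lemma snocZero_single {m : ℕ} (j : Fin m) :
    snocZero k m (Pi.single j 1) = Pi.single j.castSucc 1 := by
  funext i
  cases i using Fin.lastCases with
  | last => simp [(Fin.castSucc_ne_last j).symm]
  | cast i => simp [Pi.single_apply]

variable [CharP k 2] {G : Type v} [Group G] [IsKleinFour G] {σ τ : G}
variable (hσ : σ ≠ 1) (hτ : τ ≠ 1) (hστ : σ ≠ τ)

/-- For `m > 0` the vectors `cⱼ` generate: `d₀ = Y c₁` and `dⱼ = X cⱼ` for `j ≥ 1`. For `m = 0`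
there are none, and `d₀` is itself a generator. -/
lemma negOdd_hom_ext {m : ℕ} (hm : 0 < m) {A : Rep.{u} k G}
    {f g : negOddModule hσ hτ hστ m ⟶ A}
    (h : ∀ j, f.hom (Pi.single j 1, 0) = g.hom (Pi.single j 1, 0)) : f = g := by
  have h₁ : ∀ c, f.hom (c, 0) = g.hom (c, 0) := by
    have : f.hom.toLinearMap ∘ₗ LinearMap.inl k _ _ = g.hom.toLinearMap ∘ₗ LinearMap.inl k _ _ := by
      ext j
      exact h j
    exact fun c => LinearMap.congr_fun this c
  have hX : ∀ c, f.hom (0, consZero k m c) = g.hom (0, consZero k m c) := fun c => by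
    have := hom_kleinRep_left f (c, 0)
    rw [h₁, ← hom_kleinRep_left] at this
    exact this
  have hY : ∀ c, f.hom (0, snocZero k m c) = g.hom (0, snocZero k m c) := fun c => by
    have := hom_kleinRep_right f (c, 0)
    rw [h₁, ← hom_kleinRep_right] at this
    exact this
  obtain ⟨m, rfl⟩ : ∃ m', m = m' + 1 := ⟨m - 1, by omega⟩
  refine Rep.hom_ext (Representation.IntertwiningMap.ext (LinearMap.ext ?_))
  rintro ⟨c, d⟩
  have hd : ((c, d) : NegOdd k (m + 1)) = (c, 0) + ((0, snocZero k (m + 1) (botCoord k m (d 0))) +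
      (0, consZero k (m + 1) (fun j => d j.succ))) := by
    rw [snocZero_botCoord]
    refine Prod.ext (by simp) (Eq.trans (botCoord_add_consZero d).symm ?_)
    simp
  rw [hd]
  simp only [map_add]
  exact congrArg₂ _ (h₁ c) (congrArg₂ _ (hY _) (hX _))

/-- A matrix constant along each step of its antidiagonals depends only on the sum of its indices.
-/
lemma exists_hankel {R : Type*} {m n : ℕ} (f : Fin (m + 1) → Fin (n + 1) → R)
    (hf : ∀ (j : Fin m) (l : Fin n), f j.succ l.castSucc = f j.castSucc l.succ) :
    ∃ h : Fin (m + 1 + n) → R, ∀ (j : Fin (m + 1)) (l : Fin (n + 1)),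
      h ⟨j + l, by omega⟩ = f j l := by
  -- Read the sequence down the first column and then along the last row; these meet every
  -- antidiagonal once.
  refine ⟨fun i => if hi : i.1 ≤ m then f ⟨i, by omega⟩ 0 else f (Fin.last m) ⟨i - m, by omega⟩, ?_⟩
  have key : ∀ (l : ℕ) (hl : l < n + 1) (j : ℕ) (hj : j < m + 1),
      (if hi : j + l ≤ m then f ⟨j + l, by omega⟩ 0 else f (Fin.last m) ⟨j + l - m, by omega⟩) =
        f ⟨j, hj⟩ ⟨l, hl⟩ := by
    intro l
    induction l with
    | zero =>
      intro hl j hj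
      rw [dif_pos (by omega)]
      rfl
    | succ l ih =>
      intro hl j hj
      by_cases hjm : j < m
      · have h := hf ⟨j, hjm⟩ ⟨l, by omega⟩
        have h' := ih (by omega) (j + 1) (by omega)
        refine Eq.trans ?_ (h'.trans h)
        simp only [add_assoc, add_comm 1 l]
      · obtain rfl : j = m := by omega
        rw [dif_neg (by omega)]
        congr 1
        ext
        simp
  exact fun j l => key l l.2 j j.2

/-- The linear parametrization of the homomorphisms `V_{-(2m+1)} ⟶ V_{2n+1}`. -/
noncomputable def hankelHom (m n : ℕ) : (Fin m → Fin n → k) × (Fin (m + n) → k) →ₗ[k]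
    (negOddModule hσ hτ hστ m ⟶ kleinRep hσ hτ hστ (oddPair k n)) where
  toFun p := kleinHom hσ hτ hστ (hankelLinear m n p.1 p.2) (hankelLinear_X m n p.1 p.2)
    (hankelLinear_Y m n p.1 p.2)
  map_add' p q := by
    refine Rep.hom_ext (Representation.IntertwiningMap.ext (LinearMap.ext fun v => ?_))
    change hankelLinear m n (p.1 + q.1) (p.2 + q.2) v =
      hankelLinear m n p.1 p.2 v + hankelLinear m n q.1 q.2 v
    refine Prod.ext (funext fun l => ?_) (funext fun l => ?_)
    · simp [hankelLinear, mul_add, Finset.sum_add_distrib]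
    · simp [hankelLinear, mul_add, Finset.sum_add_distrib]
      abel
  map_smul' r p := by
    refine Rep.hom_ext (Representation.IntertwiningMap.ext (LinearMap.ext fun v => ?_))
    change hankelLinear m n (r • p.1) (r • p.2) v = r • hankelLinear m n p.1 p.2 v
    refine Prod.ext (funext fun l => ?_) (funext fun l => ?_) <;>
    simp [hankelLinear, mul_add, Finset.mul_sum, mul_left_comm]

lemma hankelHom_single (m n : ℕ) (p : (Fin m → Fin n → k) × (Fin (m + n) → k)) (j : Fin m) :
    (hankelHom hσ hτ hστ m n p).hom (Pi.single j 1, 0) =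
      ((fun l : Fin (n + 1) => p.2 ⟨j + l, by omega⟩, p.1 j) : Odd k n) :=
  hankelLinear_single m n p.1 p.2 j

lemma hankelHom_bijective {m : ℕ} (hm : 0 < m) (n : ℕ) :
    Function.Bijective (hankelHom (k := k) hσ hτ hστ m n) := by
  obtain ⟨m, rfl⟩ : ∃ m', m = m' + 1 := ⟨m - 1, by omega⟩
  constructor
  · rw [← LinearMap.ker_eq_bot, LinearMap.ker_eq_bot']
    intro p hp
    have h : ∀ j : Fin (m + 1),
        ((fun l : Fin (n + 1) => p.2 ⟨j + l, by omega⟩, p.1 j) : Odd k n) = 0 := by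
      intro j
      rw [← hankelHom_single hσ hτ hστ, hp]
      rfl
    refine Prod.ext (funext fun j => congrArg Prod.snd (h j)) (funext fun i => ?_)
    by_cases hi : i.1 ≤ m
    · exact congrFun (congrArg Prod.fst (h ⟨i, by omega⟩)) 0
    · have := congrFun (congrArg Prod.fst (h (Fin.last m))) ⟨i - m, by omega⟩
      refine Eq.trans (congrArg p.2 (Fin.ext ?_)) this
      simp
      omega
  · intro F
    -- The relation `X cⱼ = Y cⱼ₊₁` in the source forces the Hankel condition on the `a`-coordinates
    -- of the images; their `b`-coordinates are unconstrained.
    obtain ⟨h, hh⟩ := exists_hankel (fun j l => (F.hom (Pi.single j 1, 0)).1 l) (by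
      intro j l
      have h₁ := hom_X F (Pi.single j.castSucc 1, 0)
      have h₂ := hom_Y F (Pi.single j.succ 1, 0)
      have e : (negOddPair k (m + 1)).X (Pi.single j.castSucc 1, 0) =
          (negOddPair k (m + 1)).Y (Pi.single j.succ 1, 0) := by
        rw [negOddPair_X, negOddPair_Y]
        dsimp only
        rw [← snocZero_single, ← consZero_single, snocZero_consZero]
      rw [e, h₂] at h₁
      exact congrFun (congrArg Prod.snd h₁) l)
    refine ⟨(fun j => (F.hom (Pi.single j 1, 0)).2, h), negOdd_hom_ext hσ hτ hστ hm fun j => ?_⟩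
    rw [hankelHom_single]
    exact Prod.ext (funext fun l => hh j l) rfl

lemma finrank_negOdd_hom {m : ℕ} (hm : 0 < m) (n : ℕ) :
    Module.finrank k (negOddModule hσ hτ hστ m ⟶ kleinRep hσ hτ hστ (oddPair k n)) =
      m * n + (m + n) := by
  rw [← (LinearEquiv.ofBijective _ (hankelHom_bijective hσ hτ hστ hm n)).finrank_eq]
  simp [Module.finrank_pi_fintype]

end KleinFour

/-! ### Fixed vectors in `V_{2n+1}` and homomorphisms from the covers and from `V_{-1}`. -/

section KleinFour

variable {k : Type u} [Field k]

lemma finrank_of_fst_mem_span {n : ℕ} (w : Fin (n + 1) → k) (hw : w ≠ 0)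
    (K : Submodule k (Odd k n)) (hK : ∀ v, v ∈ K ↔ ∃ a : k, a • w = v.1) :
    Module.finrank k K = n + 1 := by
  let f : k × (Fin n → k) →ₗ[k] Odd k n := (LinearMap.toSpanSingleton k _ w).prodMap LinearMap.id
  have hf : Function.Injective f :=
    (LinearMap.ker_eq_bot.1 (LinearMap.ker_toSpanSingleton k hw)).prodMap Function.injective_id
  have hr : K = LinearMap.range f := by
    ext v
    rw [hK, LinearMap.mem_range]
    constructor
    · rintro ⟨a, ha⟩
      exact ⟨(a, v.2), Prod.ext ha rfl⟩
    · rintro ⟨⟨a, b⟩, rfl⟩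
      exact ⟨a, rfl⟩
  rw [hr, LinearMap.finrank_range_of_inj hf]
  simp [add_comm]

lemma finrank_ker_opX (n : ℕ) : Module.finrank k (LinearMap.ker (opX k n)) = n + 1 := by
  -- Modulo the `b`-coordinates, the kernel of `X` is the line through `a₀`.
  refine finrank_of_fst_mem_span (botCoord k n 1) (fun h => ?_) _ fun v => ?_
  · simpa using congrFun h 0
  · have hv : v ∈ LinearMap.ker (opX k n) ↔ (fun j : Fin n => v.1 j.succ) = 0 := by
      rw [LinearMap.mem_ker]
      exact ⟨fun h => congrArg Prod.snd h, fun h => Prod.ext rfl h⟩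
    rw [hv]
    constructor
    · intro h
      refine ⟨v.1 0, ?_⟩
      rw [← map_smul, smul_eq_mul, mul_one]
      conv_rhs => rw [← botCoord_add_consZero v.1, h, map_zero, add_zero]
    · rintro ⟨a, ha⟩
      funext j
      simp [← ha]

lemma finrank_ker_opY (n : ℕ) : Module.finrank k (LinearMap.ker (opY k n)) = n + 1 := by
  -- For `Y` the line is that through `aₙ`.
  refine finrank_of_fst_mem_span (topCoord k n 1) (fun h => ?_) _ fun v => ?_
  · simpa using congrFun h (Fin.last n)
  · have hv : v ∈ LinearMap.ker (opY k n) ↔ (fun j : Fin n => v.1 j.castSucc) = 0 := by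
      rw [LinearMap.mem_ker]
      exact ⟨fun h => congrArg Prod.snd h, fun h => Prod.ext rfl h⟩
    rw [hv]
    constructor
    · intro h
      refine ⟨v.1 (Fin.last n), ?_⟩
      rw [← map_smul, smul_eq_mul, mul_one]
      conv_rhs => rw [← snocZero_add_topCoord v.1, h, map_zero, zero_add]
    · rintro ⟨a, ha⟩
      funext j
      simp [← ha]

lemma finrank_ker_opX_sub_opY (n : ℕ) :
    Module.finrank k (LinearMap.ker (opX k n - opY k n)) = n + 1 := by
  -- For `X - Y` all `a`-coordinates must agree, so the line is that through `a₀ + ⋯ + aₙ`.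
  refine finrank_of_fst_mem_span (fun _ => 1) (fun h => ?_) _ fun v => ?_
  · simpa using congrFun h 0
  · have hv : v ∈ LinearMap.ker (opX k n - opY k n) ↔ ∀ j : Fin n, v.1 j.succ = v.1 j.castSucc := by
      rw [LinearMap.mem_ker, LinearMap.sub_apply, sub_eq_zero]
      exact ⟨fun h j => congrFun (congrArg Prod.snd h) j, fun h => Prod.ext rfl (funext h)⟩
    rw [hv]
    constructor
    · intro h
      refine ⟨v.1 0, funext fun j => ?_⟩
      induction j using Fin.induction with
      | zero => simp
      | succ j ih => rw [h, ← ih]; rfl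
    · rintro ⟨a, ha⟩ j
      simp [← ha]

/-- For `n > 0` each `a`-coordinate is detected by `X` or by `Y`, leaving only the `bᵢ`. For `n = 0`
there are no `bᵢ` and `a₀` itself is invariant. -/
lemma finrank_ker_opX_inf_ker_opY (n : ℕ) :
    Module.finrank k ↥(LinearMap.ker (opX k n) ⊓ LinearMap.ker (opY k n)) =
      if n = 0 then 1 else n := by
  split_ifs with hn
  · subst hn
    have h : LinearMap.ker (opX k 0) ⊓ LinearMap.ker (opY k 0) = ⊤ := by
      refine eq_top_iff.2 fun v _ => ⟨?_, ?_⟩ <;>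
      exact Prod.ext rfl (Subsingleton.elim _ _)
    rw [h, finrank_top]
    simp
  · have h : LinearMap.ker (opX k n) ⊓ LinearMap.ker (opY k n) =
        LinearMap.range (LinearMap.inr k (Fin (n + 1) → k) (Fin n → k)) := by
      ext v
      constructor
      · rintro ⟨h₁, h₂⟩
        refine ⟨v.2, Prod.ext (funext fun j => ?_) rfl⟩
        cases j using Fin.cases with
        | zero =>
          obtain ⟨n, rfl⟩ : ∃ n', n = n' + 1 := ⟨n - 1, by omega⟩
          exact (congrFun (congrArg Prod.snd h₂) 0).symm
        | succ j => exact (congrFun (congrArg Prod.snd h₁) j).symm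
      · rintro ⟨b, rfl⟩
        exact ⟨rfl, rfl⟩
    rw [h, LinearMap.finrank_range_of_inj LinearMap.inr_injective]
    simp

variable [CharP k 2] {G : Type v} [Group G] [IsKleinFour G] {σ τ : G}
variable (hσ : σ ≠ 1) (hτ : τ ≠ 1) (hστ : σ ≠ τ)

lemma aug_kleinRep_left {V : Type u} [AddCommGroup V] [Module k V] (D : SqZeroPair k V) :
    aug (kleinRep hσ hτ hστ D) σ = D.X :=
  LinearMap.ext fun v => sub_eq_of_eq_add' (kleinRepresentation_left hσ hτ hστ D v)

lemma aug_kleinRep_right {V : Type u} [AddCommGroup V] [Module k V] (D : SqZeroPair k V) :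
    aug (kleinRep hσ hτ hστ D) τ = D.Y :=
  LinearMap.ext fun v => sub_eq_of_eq_add' (kleinRepresentation_right hσ hτ hστ D v)

lemma finrank_cover_hom (m n : ℕ) :
    Module.finrank k (kleinRep hσ hτ hστ (coverPair k (Fin m → k)) ⟶
      kleinRep hσ hτ hστ (oddPair k n)) = m * (2 * n + 1) + 3 * (n + 1) := by
  rw [(coverHomEquiv hσ hτ hστ (kleinRep hσ hτ hστ (oddPair k n))).finrank_eq,
    aug_kleinRep_left, aug_kleinRep_right]
  have h₁ : Module.finrank k (LinearMap.ker (oddPair k n).X) = n + 1 := finrank_ker_opX n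
  have h₂ : Module.finrank k (LinearMap.ker (oddPair k n).Y) = n + 1 := finrank_ker_opY n
  have h₃ : Module.finrank k (LinearMap.ker ((oddPair k n).X - (oddPair k n).Y)) = n + 1 :=
    finrank_ker_opX_sub_opY n
  rw [Module.finrank_prod, Module.finrank_prod, Module.finrank_prod, h₁, h₂, h₃,
    Module.finrank_linearMap]
  simp
  ring

/-- Evaluation of homomorphisms out of `V_{-1}` at the generator. -/
noncomputable def negOddZeroEval (A : Rep.{u} k G) : (negOddModule hσ hτ hστ 0 ⟶ A) →ₗ[k] A where
  toFun f := f.hom (0, 1)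
  map_add' _ _ := rfl
  map_smul' _ _ := rfl

/-- As `V_{-1}` is trivial on one generator, evaluation identifies these homomorphisms with the
common kernel of `X` and `Y`. -/
lemma finrank_negOdd_zero_hom (n : ℕ) :
    Module.finrank k (negOddModule hσ hτ hστ 0 ⟶ kleinRep hσ hτ hστ (oddPair k n)) =
      if n = 0 then 1 else n := by
  have hinj : Function.Injective
      (negOddZeroEval hσ hτ hστ (kleinRep hσ hτ hστ (oddPair k n))) := by
    intro f g h
    refine Rep.hom_ext (Representation.IntertwiningMap.ext (LinearMap.ext ?_))
    rintro ⟨c, d⟩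
    have hd : ((c, d) : NegOdd k 0) = d 0 • (0, 1) := by
      refine Prod.ext (Subsingleton.elim _ _) (funext fun j => ?_)
      cases j using Fin.cases with
      | zero => simp
      | succ j => exact j.elim0
    rw [hd, map_smul, map_smul]
    exact congrArg _ h
  rw [← LinearMap.finrank_range_of_inj hinj, ← finrank_ker_opX_inf_ker_opY (k := k) n]
  suffices LinearMap.range (negOddZeroEval hσ hτ hστ (kleinRep hσ hτ hστ (oddPair k n))) =
    LinearMap.ker (opX k n) ⊓ LinearMap.ker (opY k n) by rw [this]
  ext v
  constructor
  · rintro ⟨f, rfl⟩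
    constructor
    · refine (hom_X f (0, 1)).symm.trans ?_
      rw [negOddPair_X, map_zero]
      exact map_zero f.hom
    · refine (hom_Y f (0, 1)).symm.trans ?_
      rw [negOddPair_Y, map_zero]
      exact map_zero f.hom
  · rintro ⟨h₁, h₂⟩
    refine ⟨kleinHom hσ hτ hστ (D := negOddPair k 0) (D' := oddPair k n)
      (LinearMap.toSpanSingleton k (Odd k n) v ∘ₗ LinearMap.proj 0 ∘ₗ
        LinearMap.snd k (Fin 0 → k) (Fin 1 → k)) (fun w => ?_) (fun w => ?_), ?_⟩
    · have h : (oddPair k n).X v = 0 := h₁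
      simp [negOddPair_X, h]
    · have h : (oddPair k n).Y v = 0 := h₂
      rw [negOddPair_Y, show w.1 = 0 from Subsingleton.elim _ _, map_zero]
      simp [h]
    · exact one_smul k v

end KleinFour

/-! ### The resolution of the trivial module and the final count. -/

section KleinFour

variable {k : Type u} [Field k] [CharP k 2] {G : Type v} [Group G] [IsKleinFour G] {σ τ : G}
variable (hσ : σ ≠ 1) (hτ : τ ≠ 1) (hστ : σ ≠ τ)

/-- The isomorphism of `V_{-1}` with the trivial module. -/
noncomputable def negOddZeroHom : negOddModule (k := k) hσ hτ hστ 0 ⟶ Rep.trivial k G k :=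
  homOfComm hσ hτ hστ (LinearMap.proj 0 ∘ₗ LinearMap.snd k (Fin 0 → k) (Fin 1 → k))
    (fun v => by
      rw [Rep.of_ρ, kleinRepresentation_left, negOddPair_X]
      simp)
    (fun v => by
      rw [Rep.of_ρ, kleinRepresentation_right, negOddPair_Y,
        show v.1 = 0 from Subsingleton.elim _ _, map_zero]
      simp)

lemma negOddZeroHom_bijective :
    Function.Bijective (negOddZeroHom (k := k) hσ hτ hστ).hom := by
  constructor
  · intro v w h
    refine Prod.ext (Subsingleton.elim _ _) (funext fun j => ?_)
    cases j using Fin.cases with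
    | zero => exact h
    | succ j => exact j.elim0
  · exact fun a => ⟨(0, fun _ => a), rfl⟩

/-- A resolution of the trivial module by finite-dimensional relatively projective modules, with
syzygies `V_{-(4i+1)}`. -/
noncomputable def trivialResolution :
    RelProjResolution (properSubgroups σ τ) (Rep.trivial k G k) :=
  -- The sequences splice on the nose because `2 * (i + 1)` is definitionally `2 * i + 2`.
  spliceResolution (fun i => negOddModule hσ hτ hστ (2 * i))
    (fun i => kleinRep hσ hτ hστ (coverPair k (Fin (2 * i) → k)))
    (fun i => coverProjHom hσ hτ hστ (2 * i)) (fun i => syzygyInclHom hσ hτ hστ (2 * i))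
    (negOddZeroHom hσ hτ hστ) (negOddZeroHom_bijective hσ hτ hστ)
    (fun i => syzygyIncl_injective (2 * i)) (fun i => exact_syzygyIncl_coverProj (2 * i))
    (fun _ => isRelProjective_cover hσ hτ hστ)
    (fun i => exists_section_coverProjHom hσ hτ hστ (2 * i))
    (fun i => coverProj_surjective (2 * i))

lemma trivialResolution_X (i : ℕ) : (trivialResolution (k := k) hσ hτ hστ).complex.X i =
    kleinRep hσ hτ hστ (coverPair k (Fin (2 * i) → k)) := rfl

instance finite_trivialResolution_X (i : ℕ) :
    Module.Finite k ((trivialResolution (k := k) hσ hτ hστ).complex.X i) :=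
  inferInstanceAs (Module.Finite k (Cover k (Fin (2 * i) → k)))

lemma exact_trivialResolution (i : ℕ) :
    Function.Exact ((trivialResolution (k := k) hσ hτ hστ).complex.d (i + 1) i).hom
      (coverProjHom (k := k) hσ hτ hστ (2 * i)).hom :=
  exact_spliceResolution _ _ _ _ _ _ _ _ _ _ _ i

lemma finite_and_finrank_ext (P : RelProjResolution (properSubgroups σ τ) (Rep.trivial k G k))
    (n : ℕ) (N : Rep.{u} k G) (e : N ≅ oddModule k hσ hτ hστ n) :
    (Module.Finite k (P.ext N 0) ∧ Module.finrank k (P.ext N 0) = if n = 0 then 1 else n) ∧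
      ∀ i : ℕ, 0 < i → Module.Finite k (P.ext N i) ∧
        (Module.finrank k (P.ext N i) : ℤ) = max 0 ((n : ℤ) + 2 * (i : ℤ) - 3) := by
  have hN : Module.Finite k N :=
    have : Module.Finite k (oddModule k hσ hτ hστ n) := inferInstanceAs (Module.Finite k (Odd k n))
    Module.Finite.equiv (Representation.equivOfIso e).symm.toLinearEquiv
  obtain ⟨⟨h₀, h₀'⟩, h₁⟩ := (trivialResolution (k := k) hσ hτ hστ).finite_and_finrank_ext
    (fun i => negOddModule hσ hτ hστ (2 * i)) (fun i => coverProjHom hσ hτ hστ (2 * i))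
    (fun i => coverProj_surjective (2 * i)) (exact_trivialResolution hσ hτ hστ) N
  have hE := fun i => (P.extIso (trivialResolution (k := k) hσ hτ hστ) N i).toLinearEquiv
  have hH : ∀ A : Rep.{u} k G, Module.finrank k (A ⟶ N) =
      Module.finrank k (A ⟶ kleinRep hσ hτ hστ (oddPair k n)) := fun A =>
    (Linear.homCongr k (Iso.refl A) e).finrank_eq
  have hz := (hH _).trans (finrank_negOdd_zero_hom (k := k) hσ hτ hστ n)
  refine ⟨⟨Module.Finite.equiv (hE 0).symm, (hE 0).finrank_eq.trans (h₀'.trans hz)⟩,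
    fun i hi => ?_⟩
  obtain ⟨i, rfl⟩ : ∃ j, i = j + 1 := ⟨i - 1, by omega⟩
  obtain ⟨h₂, h₃⟩ := h₁ i
  refine ⟨Module.Finite.equiv (hE (i + 1)).symm, ?_⟩
  rw [(hE (i + 1)).finrank_eq]
  rw [trivialResolution_X, hH, hH, hH, finrank_cover_hom,
    finrank_negOdd_hom hσ hτ hστ (by omega : 0 < 2 * (i + 1))] at h₃
  generalize Module.finrank k ((trivialResolution (k := k) hσ hτ hστ).ext N (i + 1)) = x at h₃ ⊢
  -- Degree one involves `Hom(V_{-1}, N)`, which the Hankel formula does not cover. It yields `n -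
  -- 1` for `n > 0` and `0` for `n = 0`; in higher degrees `n + 2i - 1` is nonnegative, so the
  -- maximum is inactive.
  rcases Nat.eq_zero_or_pos i with rfl | hi
  · rw [finrank_negOdd_zero_hom] at h₃
    split_ifs at h₃ <;> push_cast <;> omega
  · rw [finrank_negOdd_hom hσ hτ hστ (by omega : 0 < 2 * i)] at h₃
    zify at h₃
    rw [max_eq_right (by push_cast; omega)]
    push_cast
    linear_combination h₃

/-- The trivial module is `V₁`. -/
noncomputable def trivialIsoOddModule : Rep.trivial k G k ≅ oddModule k hσ hτ hστ 0 where
  hom := homOfComm hσ hτ hστ (A := Rep.trivial k G k) (B := kleinRep hσ hτ hστ (oddPair k 0))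
    ({ toFun a := (fun _ => a, 0), map_add' _ _ := Prod.ext rfl (Subsingleton.elim _ _),
       map_smul' _ _ := Prod.ext rfl (Subsingleton.elim _ _) } : k →ₗ[k] Odd k 0)
    (fun a => Prod.ext (by simp [oddPair, opX]) (Subsingleton.elim _ _))
    (fun a => Prod.ext (by simp [oddPair, opY]) (Subsingleton.elim _ _))
  inv := homOfComm hσ hτ hστ (A := kleinRep hσ hτ hστ (oddPair k 0)) (B := Rep.trivial k G k)
    ({ toFun v := v.1 0, map_add' _ _ := rfl, map_smul' _ _ := rfl } : Odd k 0 →ₗ[k] k)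
    (fun a => by simp [oddPair, opX]) (fun a => by simp [oddPair, opY])
  hom_inv_id := rfl
  inv_hom_id := by
    refine Rep.hom_ext (Representation.IntertwiningMap.ext (LinearMap.ext fun v => ?_))
    refine Prod.ext (funext fun j => ?_) (Subsingleton.elim _ _)
    cases j using Fin.cases with
    | zero => rfl
    | succ j => exact j.elim0

end KleinFour

end RelCohomology

theorem mainTheorem3 {k : Type u} [Field k] [CharP k 2] {G : Type v} [Group G] [IsKleinFour G]
    (σ τ : G) (hσ : σ ≠ 1) (hτ : τ ≠ 1) (hστ : σ ≠ τ) :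
    -- the trivial module has a relatively projective resolution by finite-dimensional modules
    (∃ P : RelCohomology.RelProjResolution (RelCohomology.properSubgroups σ τ)
        (Rep.trivial k G k), ∀ i, Module.Finite k (P.complex.X i)) ∧
    -- every such resolution computes the relative cohomology of `G`, with these dimensions
    (∀ P : RelCohomology.RelProjResolution (RelCohomology.properSubgroups σ τ)
        (Rep.trivial k G k),
      (∀ (n : ℕ) (N : Rep.{u} k G),
        Nonempty (N ≅ RelCohomology.oddModule k hσ hτ hστ n) →
          (Module.Finite k (P.ext N 0) ∧
            Module.finrank k (P.ext N 0) = if n = 0 then 1 else n) ∧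
          ∀ i : ℕ, 0 < i →
            Module.Finite k (P.ext N i) ∧
              (Module.finrank k (P.ext N i) : ℤ) = max 0 ((n : ℤ) + 2 * (i : ℤ) - 3)) ∧
      -- trivial coefficients, the case `n = 0`
      (Nonempty (Rep.trivial k G k ≅ RelCohomology.oddModule k hσ hτ hστ 0) ∧
        (Module.Finite k (P.ext (Rep.trivial k G k) 0) ∧
          Module.finrank k (P.ext (Rep.trivial k G k) 0) = 1) ∧
        ∀ i : ℕ, 0 < i →
          Module.Finite k (P.ext (Rep.trivial k G k) i) ∧
            (Module.finrank k (P.ext (Rep.trivial k G k) i) : ℤ) =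
              max 0 (2 * (i : ℤ) - 3))) := by
  refine ⟨⟨RelCohomology.trivialResolution hσ hτ hστ, fun i => inferInstance⟩, fun P => ⟨?_, ?_⟩⟩
  · rintro n N ⟨e⟩
    exact RelCohomology.finite_and_finrank_ext hσ hτ hστ P n N e
  · have h := RelCohomology.finite_and_finrank_ext hσ hτ hστ P 0 _
      (RelCohomology.trivialIsoOddModule hσ hτ hστ)
    exact ⟨⟨RelCohomology.trivialIsoOddModule hσ hτ hστ⟩, h.1, fun i hi =>
      ⟨(h.2 i hi).1, (h.2 i hi).2.trans (by simp)⟩⟩
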